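/- Consider formal power series $f(z)=z+\sum_{k\ge1}f_kz^{k+1}\in\mathbb C[[z]]$, write $Q(z)=z/f(z)=1+\sum_{k\ge1}q_kz^k$, and consider the differential equation $$f f'''-3f'f''=6q_1(f')^2+12q_2ff'+12q_3f^2 .\qquad(*)$$ A series solution of $(*)$ with parameters $(q_1,q_2,q_3,q_4)\in\mathbb C^4$ is such an $f$ satisfying $(*)$ for which $q_1,\dots,q_4$ are the first four coefficients of $Q=z/f$. For a lattice $L\subset\mathbb C$ and an integer $N\ge 1$, an elliptic function of level $N$ with lattice $L$ is a meromorphic function $F$ on $\mathbb C$ with $F(0)=0$, $F'(0)=1$ such that $F^N$ is an elliptic function with lattice $L$ whose divisor on $\mathbb C/L$ is $N\cdot 0-N\cdot\rho$ for some $\rho\in\mathbb C$, and such that $N$ is the least positive integer with this property. Let $U_N\subset\mathbb C^4$ be the set of those $(q_1,q_2,q_3,q_4)$ for which a series solution of $(*)$ with these parameters is the expansion at $0$ of an elliptic function of level $N$ (with some lattice), and let $M_N$ be the Zariski closure of $U_N$ in $\mathbb C^4$. A series corresponding to the elliptic function of level $N$ is a series solution of $(*)$ with parameters in $M_N$. Put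 $$P_5=5q_1^5+50q_1^3q_2+51q_1q_2^2+48q_1^2q_3+24q_2q_3+30q_1q_4,$$ $$P_6=(13q_1^3+9q_1q_2+3q_3)^2-162q_1^4(q_1^2+q_2),$$ $$P_7=56q_1^5q_2+576q_1^3q_2^2+648q_1q_2^3-15q_1^4q_3+474q_1^2q_2q_3+279q_2^2q_3-144q_1q_3^2-90q_3q_4 .$$ Theorem. The algebraic set $\{P_5=P_6=P_7=0\}\subset\mathbb C^4$ has exactly two irreducible components, one of which is $M_2$. If $A$ denotes the other one, then $A=M_6$; that is, the series corresponding to the elliptic function of level $6$ are exactly the series solutions of $(*)$ with parameters $(q_1,q_2,q_3,q_4)$ in $A$. -/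

import Mathlib

open scoped Topology

noncomputable section

/-! ### The Zariski topology on affine space and irreducible components -/

/-- The Zariski topology on `ℂⁿ`: the closed sets are the sets of common zeros of families of
polynomials. -/
@[reducible]
def zariskiTopology (n : ℕ) : TopologicalSpace (Fin n → ℂ) :=
  TopologicalSpace.ofClosed
    {Z | ∃ S : Set (MvPolynomial (Fin n) ℂ), Z = {x | ∀ p ∈ S, MvPolynomial.eval x p = 0}}
    ⟨{1}, by ext x; simp⟩
    (by
      intro A hA
      refine ⟨{p | ∀ x ∈ ⋂₀ A, MvPolynomial.eval x p = 0}, ?_⟩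
      ext x
      refine ⟨fun hx p hp => hp x hx, fun hx Z hZ => ?_⟩
      obtain ⟨S, rfl⟩ := hA hZ
      exact fun p hp => hx p fun y hy => hy _ hZ p hp)
    (by
      rintro _ ⟨S, rfl⟩ _ ⟨T, rfl⟩
      refine ⟨{r | ∃ p ∈ S, ∃ q ∈ T, r = p * q}, ?_⟩
      ext x
      constructor
      · rintro (hx | hx) _ ⟨p, hp, q, hq, rfl⟩
        · rw [map_mul, hx p hp, zero_mul]
        · rw [map_mul, hx q hq, mul_zero]
      · intro hx
        by_contra hcon
        simp only [Set.mem_union, Set.mem_ofPred_eq, not_or, not_forall] at hcon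
        obtain ⟨⟨p, hp, hpx⟩, q, hq, hqx⟩ := hcon
        have h := hx (p * q) ⟨p, hp, q, hq, rfl⟩
        rw [map_mul] at h
        exact (mul_ne_zero hpx hqx) h)

/-- The irreducible components of a subset `V` of `ℂⁿ`: the maximal elements among the subsets of
`V` that are irreducible in the Zariski topology. -/
def zariskiComponents {n : ℕ} (V : Set (Fin n → ℂ)) : Set (Set (Fin n → ℂ)) :=
  {Z | Maximal (fun W => W ⊆ V ∧ @IsIrreducible _ (zariskiTopology n) W) Z}

/-! ### Elliptic functions of level `N` -/

open Classical in
/-- The function `f ^ N` is `L`-periodic and its divisor on `ℂ / L` is `N · 0 - N · ρ` for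
some `ρ ∈ ℂ`. -/
def HasEllipticPower (L : PeriodPair) (N : ℕ) (f : ℂ → ℂ) : Prop :=
  (∀ ω ∈ L.lattice, Function.Periodic (fun z => f z ^ N) ω) ∧
  ∃ ρ : ℂ, ∀ z : ℂ, meromorphicOrderAt (fun w => f w ^ N) z =
    (((if z ∈ L.lattice then (N : ℤ) else 0) - (if z - ρ ∈ L.lattice then (N : ℤ) else 0) : ℤ) :
      WithTop ℤ)

/-- `f` is an elliptic function of level `N` with lattice `L`: a meromorphic function on `ℂ` with
`f 0 = 0`, `f' 0 = 1` such that `N` is the least positive integer for which `f ^ N` is elliptic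
with lattice `L` and divisor of the form `N · 0 - N · ρ`. A meromorphic function is represented by
its normal form: analytic away from its poles, with value `0` at the poles. -/
def IsEllipticOfLevel (N : ℕ) (L : PeriodPair) (f : ℂ → ℂ) : Prop :=
  MeromorphicNFOn f Set.univ ∧ f 0 = 0 ∧ deriv f 0 = 1 ∧
  IsLeast {k : ℕ | 0 < k ∧ HasEllipticPower L k f} N

/-! ### The differential equation and its series solutions -/

/-- Points of `ℂ⁴` are quadruples `(q₁, q₂, q₃, q₄)`, with `qᵢ = q (i - 1)`.

The series `f = z + ⋯` is a solution of
`f f''' - 3 f' f'' = 6 q₁ (f')² + 12 q₂ f f' + 12 q₃ f²`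
with parameters `q`: the series `Q = 1 + ⋯` with `Q f = z` begins
`Q = 1 + q₁ z + q₂ z² + q₃ z³ + q₄ z⁴ + ⋯`. -/
def IsSeriesSolution (q : Fin 4 → ℂ) (f : PowerSeries ℂ) : Prop :=
  PowerSeries.coeff 0 f = 0 ∧ PowerSeries.coeff 1 f = 1 ∧
  (∃ Q : PowerSeries ℂ, Q * f = PowerSeries.X ∧ PowerSeries.coeff 0 Q = 1 ∧
    ∀ i : Fin 4, PowerSeries.coeff ((i : ℕ) + 1) Q = q i) ∧
  (let f₁ := PowerSeries.derivative ℂ f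
   let f₂ := PowerSeries.derivative ℂ f₁
   let f₃ := PowerSeries.derivative ℂ f₂
   f * f₃ - 3 * f₁ * f₂ =
    (6 * q 0) • f₁ ^ 2 + (12 * q 1) • (f * f₁) + (12 * q 2) • f ^ 2)

/-- `f` is the convergent power series expansion at zero of the function `F`. -/
def IsSeriesExpansion (F : ℂ → ℂ) (f : PowerSeries ℂ) : Prop :=
  HasFPowerSeriesAt F (FormalMultilinearSeries.ofScalars ℂ fun k => PowerSeries.coeff k f) 0

/-- `U_N ⊆ ℂ⁴`: the parameters for which the series solution of the differential equation is the
series expansion at zero of an elliptic function of level `N` with some lattice. -/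
def levelSet (N : ℕ) : Set (Fin 4 → ℂ) :=
  {q | ∃ f : PowerSeries ℂ, IsSeriesSolution q f ∧
    ∃ (L : PeriodPair) (F : ℂ → ℂ), IsEllipticOfLevel N L F ∧ IsSeriesExpansion F f}

/-- `M_N`: the Zariski closure of `U_N` in `ℂ⁴`. -/
def levelVariety (N : ℕ) : Set (Fin 4 → ℂ) :=
  closure[zariskiTopology 4] (levelSet N)

/-- `f` is a series corresponding to the elliptic function of level `N`: a series solution of the
differential equation with parameters in `M_N`. -/
def CorrespondsToLevel (N : ℕ) (f : PowerSeries ℂ) : Prop :=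
  ∃ q ∈ levelVariety N, IsSeriesSolution q f

/-! ### The variety `P₅ = P₆ = P₇ = 0` -/

def P5 (q₁ q₂ q₃ q₄ : ℂ) : ℂ :=
  5 * q₁ ^ 5 + 50 * q₁ ^ 3 * q₂ + 51 * q₁ * q₂ ^ 2 + 48 * q₁ ^ 2 * q₃ + 24 * q₂ * q₃ + 30 * q₁ * q₄

def P6 (q₁ q₂ q₃ : ℂ) : ℂ :=
  (13 * q₁ ^ 3 + 9 * q₁ * q₂ + 3 * q₃) ^ 2 - 162 * q₁ ^ 4 * (q₁ ^ 2 + q₂)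

def P7 (q₁ q₂ q₃ q₄ : ℂ) : ℂ :=
  56 * q₁ ^ 5 * q₂ + 576 * q₁ ^ 3 * q₂ ^ 2 + 648 * q₁ * q₂ ^ 3 - 15 * q₁ ^ 4 * q₃ +
    474 * q₁ ^ 2 * q₂ * q₃ + 279 * q₂ ^ 2 * q₃ - 144 * q₁ * q₃ ^ 2 - 90 * q₃ * q₄

/-- The algebraic set `P₅ = P₆ = P₇ = 0` in `ℂ⁴`. -/
def V567 : Set (Fin 4 → ℂ) :=
  {q | P5 (q 0) (q 1) (q 2) (q 3) = 0 ∧ P6 (q 0) (q 1) (q 2) = 0 ∧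
    P7 (q 0) (q 1) (q 2) (q 3) = 0}

end

/-!
The proof identifies three sets in `ℂ⁴`: the locus `P₅ = P₆ = P₇ = 0`, and the Zariski closures of
the parameter sets of the elliptic functions of levels two and six.

*The algebraic set.* On `q₁ ≠ 0` the equation `P₆ = 0` makes `(q₁ ^ 2 + q₂) / 2` the square of a
rational function `t`, and `P₅ = 0` is linear in `q₄`. So the locus is the union of `evenPlane`,
given by `q₁ = q₃ = 0`, and of `surface`, the image of the weighted homogeneous polynomial map
`surfaceMap` of `q₁` and `t`. Both are closed, they are irreducible as images of affine spaces, and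
neither contains the other (`zariskiComponents_V567`).

*Parameters of a level function.* Let `F` have level `N`, with pole at `ρ`, and let `u = F' / F`. It
is elliptic, invariant under `z ↦ ρ - z`, and has simple poles at `0` and `ρ` only. By Liouville's
theorem every such function with poles of order at most `n` is a polynomial of degree at most `n`
in `u` (`IsSymmElliptic.exists_polynomial`). In particular `u' ^ 2 = R (u)` with `R` a monic
quartic. Comparing expansions at the origin, the coefficients of `R` are polynomials in
`q₁, …, q₄`, and differentiating the equation gives the differential equation of the theorem.

For `N = 2 k` and a suitable constant `m`, the squares of `F⁻¹ ^ k ± m F ^ k` are polynomials `P` and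
`P - 4 m` in `u`, and comparing derivatives gives a Pell equation `R T ^ 2 = P (P - 4 m)` with
`P' = 2 k X T` (`IsLevelFunction.exists_pell`). When `k = 1` this forces `R` to be even, so that
`q₁ = q₃ = 0`. When `k = 3`, neither factor on the right is a square, as otherwise `F ^ 3` would be
elliptic; so `R` splits into two quadratic factors whose coefficients satisfy two cubic
relations. These put `q` on `surface` with `q₁ ≠ 0`, or on `evenPlane`; the latter is impossible, for
then uniqueness of series solutions makes `F` odd and `F ^ 2` elliptic.

*Density.* The quotients `θ (z) / θ (z - 1 / N)` of theta functions of the lattices `ℤ + ℤ τ` have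
level `N`, and scaling the variable acts on the parameters with weights `1, 2, 3, 4`. If `τ` and
`τ'` give the same orbit under this action, then the two functions agree up to scaling, and `τ` is a
quotient of two elements of the lattice of `τ'`. So the orbits are uncountable in number
(`exists_parameter_family`). Away from a curve, each of `evenPlane` and `surface` is swept out by a
one-parameter family of orbits, on which `q₄ / q₂ ^ 2`, respectively `t / q₁`, is the parameter. A
polynomial that vanishes on infinitely many of these orbits vanishes on the whole set
(`levelVariety_two`, `levelVariety_six`).
-/

open scoped Topology

noncomputable section

/-! ### Formal solutions of the differential equation -/

section Formal

open PowerSeries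

local notation "∂" => PowerSeries.derivative ℂ

/-- The first five coefficients of the power series `P` are `a₀, …, a₄`. -/
def HasJet (P : PowerSeries ℂ) (a₀ a₁ a₂ a₃ a₄ : ℂ) : Prop :=
  coeff 0 P = a₀ ∧ coeff 1 P = a₁ ∧ coeff 2 P = a₂ ∧ coeff 3 P = a₃ ∧ coeff 4 P = a₄

theorem HasJet.mul {P R : PowerSeries ℂ} {a₀ a₁ a₂ a₃ a₄ b₀ b₁ b₂ b₃ b₄ : ℂ}
    (hP : HasJet P a₀ a₁ a₂ a₃ a₄) (hR : HasJet R b₀ b₁ b₂ b₃ b₄) :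
    HasJet (P * R) (a₀ * b₀) (a₀ * b₁ + a₁ * b₀) (a₀ * b₂ + a₁ * b₁ + a₂ * b₀)
      (a₀ * b₃ + a₁ * b₂ + a₂ * b₁ + a₃ * b₀)
      (a₀ * b₄ + a₁ * b₃ + a₂ * b₂ + a₃ * b₁ + a₄ * b₀) := by
  obtain ⟨rfl, rfl, rfl, rfl, rfl⟩ := hP
  obtain ⟨rfl, rfl, rfl, rfl, rfl⟩ := hR
  refine ⟨?_, ?_, ?_, ?_, ?_⟩ <;>
    simp [coeff_mul, Finset.Nat.sum_antidiagonal_eq_sum_range_succ_mk, Finset.sum_range_succ]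

theorem HasJet.add {P R : PowerSeries ℂ} {a₀ a₁ a₂ a₃ a₄ b₀ b₁ b₂ b₃ b₄ : ℂ}
    (hP : HasJet P a₀ a₁ a₂ a₃ a₄) (hR : HasJet R b₀ b₁ b₂ b₃ b₄) :
    HasJet (P + R) (a₀ + b₀) (a₁ + b₁) (a₂ + b₂) (a₃ + b₃) (a₄ + b₄) := by
  obtain ⟨rfl, rfl, rfl, rfl, rfl⟩ := hP
  obtain ⟨rfl, rfl, rfl, rfl, rfl⟩ := hR
  exact ⟨map_add _ _ _, map_add _ _ _, map_add _ _ _, map_add _ _ _, map_add _ _ _⟩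

theorem HasJet.sub {P R : PowerSeries ℂ} {a₀ a₁ a₂ a₃ a₄ b₀ b₁ b₂ b₃ b₄ : ℂ}
    (hP : HasJet P a₀ a₁ a₂ a₃ a₄) (hR : HasJet R b₀ b₁ b₂ b₃ b₄) :
    HasJet (P - R) (a₀ - b₀) (a₁ - b₁) (a₂ - b₂) (a₃ - b₃) (a₄ - b₄) := by
  obtain ⟨rfl, rfl, rfl, rfl, rfl⟩ := hP
  obtain ⟨rfl, rfl, rfl, rfl, rfl⟩ := hR
  exact ⟨map_sub _ _ _, map_sub _ _ _, map_sub _ _ _, map_sub _ _ _, map_sub _ _ _⟩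

theorem hasJet_C (c : ℂ) : HasJet (C c) c 0 0 0 0 := by
  simp [HasJet, coeff_C]

theorem HasJet.X_mul {P : PowerSeries ℂ} {a₀ a₁ a₂ a₃ a₄ : ℂ} (hP : HasJet P a₀ a₁ a₂ a₃ a₄) :
    HasJet (X * P) 0 a₀ a₁ a₂ a₃ := by
  obtain ⟨rfl, rfl, rfl, rfl, rfl⟩ := hP
  exact ⟨coeff_zero_X_mul _, coeff_succ_X_mul 0 _, coeff_succ_X_mul 1 _, coeff_succ_X_mul 2 _,
    coeff_succ_X_mul 3 _⟩

/-- The formal series `f` vanishes at the origin with derivative one, and its logarithmic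
derivative `u = f' / f` satisfies `u' ^ 2 = u ^ 4 + r₃ u ^ 3 + r₂ u ^ 2 + r₁ u + r₀`
(the denominators `f` are cleared). -/
def LogDerivQuartic (r₃ r₂ r₁ r₀ : ℂ) (f : PowerSeries ℂ) : Prop :=
  coeff 0 f = 0 ∧ coeff 1 f = 1 ∧
  (f * ∂ (∂ f) - ∂ f ^ 2) ^ 2 = ∂ f ^ 4 + C r₃ * (∂ f ^ 3 * f) + C r₂ * (∂ f ^ 2 * f ^ 2) +
    C r₁ * (∂ f * f ^ 3) + C r₀ * f ^ 4

/-- The coefficients of the quartic are determined by the first four coefficients of `z / f`. -/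
theorem LogDerivQuartic.coeff_eq {r₃ r₂ r₁ r₀ : ℂ} {f Q : PowerSeries ℂ}
    (hf : LogDerivQuartic r₃ r₂ r₁ r₀ f) (hQ : Q * f = X) (hQ0 : coeff 0 Q = 1) :
    r₃ = 4 * coeff 1 Q ∧ r₂ = 12 * coeff 2 Q ∧ r₁ = 24 * coeff 3 Q ∧
      r₀ = 40 * coeff 4 Q - 16 * coeff 1 Q * coeff 3 Q + 8 * coeff 2 Q ^ 2 := by
  obtain ⟨h0, h1, h⟩ := hf
  have hd1 : Q * ∂ f = 1 - f * ∂ Q := by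
    have := congrArg ∂ hQ
    simp only [Derivation.leibniz, smul_eq_mul, derivative_X] at this
    linear_combination this
  have hN : Q ^ 2 * ∂ f = Q - X * ∂ Q := by
    linear_combination Q * hd1 - ∂ Q * hQ
  have hd2 : Q ^ 2 * ∂ (∂ f) + 2 * Q * ∂ Q * ∂ f = - (X * ∂ (∂ Q)) := by
    have := congrArg ∂ hN
    simp only [Derivation.leibniz, smul_eq_mul, derivative_X, map_sub, pow_two] at this
    linear_combination this
  have hN2 : Q ^ 3 * ∂ (∂ f) = - (Q * (X * ∂ (∂ Q))) - 2 * ((Q - X * ∂ Q) * ∂ Q) := by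
    linear_combination Q * hd2 - 2 * ∂ Q * hN
  set N := Q - X * ∂ Q with hNdef
  set M := - (Q * (X * ∂ (∂ Q))) - 2 * (N * ∂ Q) with hM
  -- the equation for `f` multiplied by `Q ^ 8`
  have key : (X * M - N * N) * (X * M - N * N) = N * N * (N * N) + C r₃ * (N * N * N * (X * Q)) +
      C r₂ * (N * N * (X * Q * (X * Q))) + C r₁ * (N * (X * Q * (X * Q * (X * Q)))) +
      C r₀ * (X * Q * (X * Q) * (X * Q * (X * Q))) := by
    rw [← hN2, ← hN, ← hQ]
    linear_combination Q ^ 8 * h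
  have jQ : HasJet Q 1 (coeff 1 Q) (coeff 2 Q) (coeff 3 Q) (coeff 4 Q) := ⟨hQ0, rfl, rfl, rfl, rfl⟩
  have jXdQ : HasJet (X * ∂ Q) 0 (coeff 1 Q) (2 * coeff 2 Q) (3 * coeff 3 Q) (4 * coeff 4 Q) := by
    refine ⟨by simp, ?_, ?_, ?_, ?_⟩ <;> rw [coeff_succ_X_mul, coeff_derivative] <;> push_cast <;>
      ring
  have jX2d2Q : HasJet (X * (X * ∂ (∂ Q))) 0 0 (2 * coeff 2 Q) (6 * coeff 3 Q)
      (12 * coeff 4 Q) := by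
    refine ⟨by simp, by rw [coeff_succ_X_mul]; simp, ?_, ?_, ?_⟩ <;>
      rw [coeff_succ_X_mul, coeff_succ_X_mul, coeff_derivative, coeff_derivative] <;> push_cast <;>
      ring
  have jN := jQ.sub jXdQ
  rw [← hNdef] at jN
  have jXM : X * M = C (-1) * (Q * (X * (X * ∂ (∂ Q)))) - C 2 * (N * (X * ∂ Q)) := by
    rw [hM, map_neg, map_one, map_ofNat]
    ring
  have jA := (((hasJet_C (-1)).mul (jQ.mul jX2d2Q)).sub ((hasJet_C 2).mul (jN.mul jXdQ))).sub
    (jN.mul jN)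
  rw [← jXM] at jA
  have jXQ := jQ.X_mul
  have jL := jA.mul jA
  have jR := ((((jN.mul jN).mul (jN.mul jN)).add
    ((hasJet_C r₃).mul (((jN.mul jN).mul jN).mul jXQ))).add
    ((hasJet_C r₂).mul ((jN.mul jN).mul (jXQ.mul jXQ)))).add
    ((hasJet_C r₁).mul (jN.mul (jXQ.mul (jXQ.mul jXQ)))) |>.add
    ((hasJet_C r₀).mul ((jXQ.mul jXQ).mul (jXQ.mul jXQ)))
  rw [key] at jL
  obtain ⟨-, l1, l2, l3, l4⟩ := jL
  obtain ⟨-, k1, k2, k3, k4⟩ := jR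
  have e1 := l1.symm.trans k1
  have e2 := l2.symm.trans k2
  have e3 := l3.symm.trans k3
  have e4 := l4.symm.trans k4
  clear l1 l2 l3 l4 k1 k2 k3 k4 jA jN jXM jXQ jX2d2Q jXdQ jQ key hN2 hd2 hN hd1 h
  have f3 : r₃ = 4 * coeff 1 Q := by linear_combination -e1
  subst f3
  have f2 : r₂ = 12 * coeff 2 Q := by linear_combination -e2
  subst f2
  have f1 : r₁ = 24 * coeff 3 Q := by linear_combination -e3
  subst f1
  exact ⟨rfl, rfl, rfl, by linear_combination -e4⟩

theorem exists_mul_eq_X {f : PowerSeries ℂ} (h0 : coeff 0 f = 0) (h1 : coeff 1 f = 1) :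
    ∃ Q : PowerSeries ℂ, Q * f = X ∧ coeff 0 Q = 1 := by
  obtain ⟨g, rfl⟩ := X_dvd_iff.mpr (by simpa using h0)
  have hg : constantCoeff g = 1 := by
    simpa [coeff_succ_X_mul] using h1
  refine ⟨g⁻¹, ?_, by simp [hg]⟩
  rw [mul_left_comm, PowerSeries.inv_mul_cancel g (by simp [hg]), mul_one]

/-- Differentiating the first-order equation for the logarithmic derivative gives the third-order
equation for `f`. -/
theorem LogDerivQuartic.isSeriesSolution {r₃ r₂ r₁ r₀ : ℂ} {f Q : PowerSeries ℂ}
    (hf : LogDerivQuartic r₃ r₂ r₁ r₀ f) (hQ : Q * f = X) (hQ0 : coeff 0 Q = 1) :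
    IsSeriesSolution ![coeff 1 Q, coeff 2 Q, coeff 3 Q, coeff 4 Q] f := by
  obtain ⟨e3, e2, e1, -⟩ := hf.coeff_eq hQ hQ0
  obtain ⟨h0, h1, h⟩ := hf
  refine ⟨h0, h1, ⟨Q, hQ, hQ0, fun i => by fin_cases i <;> rfl⟩, ?_⟩
  have hf0 : f ≠ 0 := by
    rintro rfl
    simp at h1
  set D := f * ∂ (∂ f) - ∂ f ^ 2 with hD
  have hD0 : D ≠ 0 := by
    intro hD0
    have := congrArg (coeff 0) (hD.symm.trans hD0)
    simp only [coeff_zero_eq_constantCoeff, map_sub, map_mul, map_pow] at this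
    rw [show constantCoeff f = 0 by simpa using h0,
      show constantCoeff (∂ f) = 1 by
        rw [← coeff_zero_eq_constantCoeff_apply, coeff_derivative]; simpa using h1] at this
    simp at this
  have hdD : ∂ D = f * ∂ (∂ (∂ f)) - ∂ f * ∂ (∂ f) := by
    rw [hD]
    simp only [map_sub, Derivation.leibniz, smul_eq_mul, pow_two]
    ring
  have hdh := congrArg ∂ h
  simp only [map_add, Derivation.leibniz, Derivation.leibniz_pow, smul_eq_mul, derivative_C,
    nsmul_eq_mul, Nat.cast_ofNat, mul_zero, add_zero] at hdh
  norm_num at hdh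
  have key : f * (2 * (f * ∂ (∂ (∂ f)) - 3 * ∂ f * ∂ (∂ f)) -
      (3 * C r₃ * ∂ f ^ 2 + 2 * C r₂ * (f * ∂ f) + C r₁ * f ^ 2)) = 0 := by
    have : D * (f * (2 * (f * ∂ (∂ (∂ f)) - 3 * ∂ f * ∂ (∂ f)) -
      (3 * C r₃ * ∂ f ^ 2 + 2 * C r₂ * (f * ∂ f) + C r₁ * f ^ 2))) = 0 := by
      rw [hdD, hD] at hdh
      rw [hD] at h ⊢
      linear_combination f * hdh - 4 * ∂ f * h
    exact (mul_eq_zero.mp this).resolve_left hD0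
  have key2 := (mul_eq_zero.mp key).resolve_left hf0
  rw [e3, e2, e1] at key2
  simp only [map_mul, map_ofNat] at key2
  simp only [smul_eq_C_mul, map_mul, map_ofNat, Matrix.cons_val_zero, Matrix.cons_val_one,
    Matrix.cons_val]
  have h2 : (2 : PowerSeries ℂ) ≠ 0 := by
    rw [← map_ofNat (C (R := ℂ)) 2]
    simp
  apply mul_left_cancel₀ h2
  linear_combination key2

/-- Two solutions with the same parameters agree up to order five, and from then on the linear
part of the equation at order `n` is multiplication by `n (n - 1) (n - 5)`, which does not
vanish. -/
theorem IsSeriesSolution.unique {q : Fin 4 → ℂ} {f g : PowerSeries ℂ} (hf : IsSeriesSolution q f)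
    (hg : IsSeriesSolution q g) : f = g := by
  obtain ⟨f0, f1, ⟨Q, hQ, hQ0, hQq⟩, hf⟩ := hf
  obtain ⟨g0, g1, ⟨R, hR, hR0, hRq⟩, hg⟩ := hg
  -- `Q R (f - g) = X (R - Q)`, and `R - Q` is divisible by `X ^ 5`
  have hRQ : X ^ 5 ∣ R - Q := by
    rw [X_pow_dvd_iff]
    intro m hm
    rw [map_sub, sub_eq_zero]
    match m, hm with
    | 0, _ => rw [hR0, hQ0]
    | m + 1, hm => exact (hRq ⟨m, by omega⟩).trans (hQq ⟨m, by omega⟩).symm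
  have hunit : IsUnit (Q * R) := by
    rw [isUnit_iff_constantCoeff, map_mul]
    simp only [coeff_zero_eq_constantCoeff] at hQ0 hR0
    simp [hQ0, hR0]
  have h6 : X ^ 6 ∣ f - g := by
    rw [← hunit.dvd_mul_left, show Q * R * (f - g) = X * (R - Q) by
      linear_combination R * hQ - Q * hR, pow_succ']
    exact mul_dvd_mul_left X hRQ
  have hstep : ∀ n : ℕ, X ^ (n + 6) ∣ f - g → X ^ (n + 7) ∣ f - g := by
    rintro n ⟨e, he⟩
    obtain ⟨h, rfl⟩ : X ∣ g := X_dvd_iff.mpr (by simpa using g0)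
    have hh : constantCoeff h = 1 := by simpa [coeff_succ_X_mul] using g1
    have hd (m : ℕ) (p : PowerSeries ℂ) :
        ∂ (X ^ (m + 1) * p) = X ^ m * (((m + 1 : ℕ) : PowerSeries ℂ) * p + X * ∂ p) := by
      simp only [Derivation.leibniz, Derivation.leibniz_pow, smul_eq_mul, derivative_X,
        nsmul_eq_mul, Nat.add_sub_cancel]
      ring
    obtain ⟨d, rfl⟩ : ∃ d, f = X * h + d := ⟨f - X * h, by ring⟩
    rw [add_sub_cancel_left] at he ⊢
    have d1 := congrArg ∂ he
    rw [hd] at d1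
    set e1 := ((n + 5 + 1 : ℕ) : PowerSeries ℂ) * e + X * ∂ e with he1
    have d2 := hd (n + 4) e1
    set e2 := ((n + 4 + 1 : ℕ) : PowerSeries ℂ) * e1 + X * ∂ e1 with he2
    have d3 := hd (n + 3) e2
    set e3 := ((n + 3 + 1 : ℕ) : PowerSeries ℂ) * e2 + X * ∂ e2 with he3
    have hg1 : constantCoeff (∂ (X * h)) = 1 := by simp [hh]
    simp only [map_add, d1, d2, d3, smul_eq_C_mul] at hf
    simp only [smul_eq_C_mul] at hg
    set g' := ∂ (X * h)
    set g'' := ∂ g'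
    set g''' := ∂ g''
    have key : X ^ (n + 4) * (X ^ 2 * e * (g''' + X ^ (n + 3) * e3) + h * e3 -
        3 * (X * e1 * (g'' + X ^ (n + 4) * e2) + g' * e2)) = X ^ (n + 4) *
        (C (6 * q 0) * ((2 * g' + X ^ (n + 5) * e1) * (X * e1)) +
        C (12 * q 1) * (X ^ 2 * e * (g' + X ^ (n + 5) * e1) + h * X ^ 2 * e1) +
        C (12 * q 2) * ((2 * X * h + d) * (X ^ 2 * e))) := by
      rw [he] at hf ⊢
      linear_combination hf - hg
    have key2 := congrArg constantCoeff (mul_left_cancel₀ (pow_ne_zero _ X_ne_zero) key)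
    have hc : constantCoeff e3 = (n + 4) * ((n + 5) * ((n + 6) * constantCoeff e)) := by
      simp [he3, he2, he1, map_ofNat]
      ring
    have hc2 : constantCoeff e2 = (n + 5) * ((n + 6) * constantCoeff e) := by
      simp [he2, he1, map_ofNat]
      ring
    simp [hh, hg1, hc, hc2, map_ofNat] at key2
    have he0 : constantCoeff e = 0 := by
      have : ((n : ℂ) + 1) * ((n + 5) * ((n + 6) * constantCoeff e)) = 0 := by
        linear_combination key2
      have h1 : (n : ℂ) + 1 ≠ 0 := by exact_mod_cast Nat.succ_ne_zero n
      have h5 : (n : ℂ) + 5 ≠ 0 := by exact_mod_cast Nat.succ_ne_zero (n + 4)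
      have h6 : (n : ℂ) + 6 ≠ 0 := by exact_mod_cast Nat.succ_ne_zero (n + 5)
      simpa [h1, h5, h6] using this
    rw [he, pow_succ]
    exact mul_dvd_mul_left _ (X_dvd_iff.mpr he0)
  have hall : ∀ n : ℕ, X ^ (n + 6) ∣ f - g := fun n => by
    induction n with
    | zero => exact h6
    | succ n ih => exact hstep n ih
  rw [← sub_eq_zero]
  ext m
  exact (X_pow_dvd_iff.mp (hall m)) m (by omega)

/-- Weighted action of the multiplicative group on parameters: replacing the series `f (z)` by
`f (μ z) / μ` multiplies `qᵢ` by `μ ^ i`. -/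
def weightedScale (μ : ℂ) (q : Fin 4 → ℂ) : Fin 4 → ℂ := fun i => μ ^ ((i : ℕ) + 1) * q i

theorem derivative_rescale (μ : ℂ) (f : PowerSeries ℂ) :
    ∂ (rescale μ f) = C μ * rescale μ (∂ f) := by
  ext n
  simp only [coeff_derivative, coeff_rescale, coeff_C_mul]
  ring

theorem IsSeriesSolution.rescale {q : Fin 4 → ℂ} {f : PowerSeries ℂ} {μ : ℂ} (hμ : μ ≠ 0)
    (hf : IsSeriesSolution q f) :
    IsSeriesSolution (weightedScale μ q) (C μ⁻¹ * PowerSeries.rescale μ f) := by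
  obtain ⟨f0, f1, ⟨Q, hQ, hQ0, hQq⟩, hf⟩ := hf
  have hC : C μ⁻¹ * C μ = (1 : PowerSeries ℂ) := by
    rw [← map_mul, inv_mul_cancel₀ hμ, map_one]
  refine ⟨?_, ?_, ⟨PowerSeries.rescale μ Q, ?_, ?_, fun i => ?_⟩, ?_⟩
  · rw [coeff_C_mul, coeff_rescale, f0]; simp
  · rw [coeff_C_mul, coeff_rescale, f1]; simp [hμ]
  · rw [mul_left_comm, ← map_mul, hQ, rescale_X, ← mul_assoc, hC, one_mul]
  · simp only [coeff_rescale, hQ0, pow_zero, one_mul]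
  · rw [coeff_rescale, hQq]; rfl
  · have h := congrArg (PowerSeries.rescale μ) hf
    simp only [smul_eq_C_mul, map_sub, map_mul, map_add, map_pow, map_ofNat] at h
    simp only [weightedScale, Derivation.leibniz, derivative_rescale, derivative_C, smul_eq_mul,
      mul_zero, add_zero, smul_eq_C_mul, map_mul, map_pow, map_ofNat]
    have hr (c : ℂ) : PowerSeries.rescale μ (C c) = C c := by
      ext n; simp only [coeff_rescale, coeff_C]; split_ifs with h <;> simp [h]
    simp only [hr] at h
    simp only [← mul_assoc, hC, one_mul]
    norm_num
    set F := PowerSeries.rescale μ f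
    set F₁ := PowerSeries.rescale μ (∂ f)
    set F₃ := PowerSeries.rescale μ (∂ (∂ (∂ f)))
    linear_combination C μ * h + (F * C μ * F₃ - 12 * C (q 1) * F * F₁ * C μ -
      12 * C (q 2) * F ^ 2 * C μ * (C μ⁻¹ * C μ + 1)) * hC

end Formal

/-! ### Taylor series of analytic functions at the origin -/

section Taylor

open PowerSeries Filter
open scoped Nat

/-- The Taylor series at the origin, as a formal power series. -/
def taylorSeries (F : ℂ → ℂ) : PowerSeries ℂ := PowerSeries.mk fun k => iteratedDeriv k F 0 / k !

theorem isSeriesExpansion_taylorSeries {F : ℂ → ℂ} (hF : AnalyticAt ℂ F 0) :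
    IsSeriesExpansion F (taylorSeries F) := by
  simpa only [IsSeriesExpansion, taylorSeries, coeff_mk] using hF.hasFPowerSeriesAt

theorem IsSeriesExpansion.eq_taylorSeries {F : ℂ → ℂ} {f : PowerSeries ℂ}
    (h : IsSeriesExpansion F f) : f = taylorSeries F := by
  have h1 := isSeriesExpansion_taylorSeries h.analyticAt
  have h2 := h.eq_formalMultilinearSeries h1
  rw [FormalMultilinearSeries.ofScalars_series_eq_iff] at h2
  ext k
  exact congrFun h2 k

theorem eventuallyEq_of_taylorSeries_eq {F G : ℂ → ℂ} (hF : AnalyticAt ℂ F 0)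
    (hG : AnalyticAt ℂ G 0) (h : taylorSeries F = taylorSeries G) : F =ᶠ[𝓝 0] G := by
  have h1 := isSeriesExpansion_taylorSeries hF
  have h2 := isSeriesExpansion_taylorSeries hG
  rw [h] at h1
  have h3 := HasFPowerSeriesAt.sub h1 h2
  rw [sub_self] at h3
  filter_upwards [h3.eventually_eq_zero] with z hz
  exact sub_eq_zero.mp hz

theorem taylorSeries_congr {F G : ℂ → ℂ} (h : F =ᶠ[𝓝 0] G) : taylorSeries F = taylorSeries G := by
  ext k
  simp only [taylorSeries, coeff_mk, h.iteratedDeriv_eq]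

theorem taylorSeries_add {F G : ℂ → ℂ} (hF : AnalyticAt ℂ F 0) (hG : AnalyticAt ℂ G 0) :
    taylorSeries (fun z => F z + G z) = taylorSeries F + taylorSeries G := by
  ext k
  simp only [taylorSeries, coeff_mk, map_add]
  rw [iteratedDeriv_fun_add hF.contDiffAt hG.contDiffAt, add_div]

theorem taylorSeries_const (c : ℂ) : taylorSeries (fun _ => c) = C c := by
  ext k
  rw [taylorSeries, coeff_mk, iteratedDeriv_const, coeff_C]
  split_ifs with h <;> simp [h]

theorem taylorSeries_mul {F G : ℂ → ℂ} (hF : AnalyticAt ℂ F 0) (hG : AnalyticAt ℂ G 0) :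
    taylorSeries (fun z => F z * G z) = taylorSeries F * taylorSeries G := by
  ext k
  simp only [taylorSeries, coeff_mk, coeff_mul]
  rw [Finset.Nat.sum_antidiagonal_eq_sum_range_succ_mk,
    show (fun z => F z * G z) = F * G from rfl, iteratedDeriv_mul hF.contDiffAt hG.contDiffAt,
    Finset.sum_div]
  refine Finset.sum_congr rfl fun i hi => ?_
  have hik : i ≤ k := by simpa [Nat.lt_succ_iff] using hi
  rw [Nat.cast_choose ℂ hik]
  have h1 : (k ! : ℂ) ≠ 0 := by exact_mod_cast k.factorial_ne_zero
  have h2 : (i ! : ℂ) ≠ 0 := by exact_mod_cast i.factorial_ne_zero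
  have h3 : ((k - i)! : ℂ) ≠ 0 := by exact_mod_cast (k - i).factorial_ne_zero
  field_simp

theorem taylorSeries_pow {F : ℂ → ℂ} (hF : AnalyticAt ℂ F 0) (n : ℕ) :
    taylorSeries (fun z => F z ^ n) = taylorSeries F ^ n := by
  induction n with
  | zero => simp [taylorSeries_const]
  | succ n ih =>
    simp only [pow_succ]
    rw [taylorSeries_mul (hF.fun_pow n) hF, ih]

theorem taylorSeries_deriv (F : ℂ → ℂ) :
    taylorSeries (deriv F) = PowerSeries.derivative ℂ (taylorSeries F) := by
  ext k
  rw [coeff_derivative]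
  simp only [taylorSeries, coeff_mk, iteratedDeriv_succ', Nat.factorial_succ, Nat.cast_mul,
    Nat.cast_succ]
  have h1 : (k ! : ℂ) ≠ 0 := by exact_mod_cast k.factorial_ne_zero
  have h2 : (k : ℂ) + 1 ≠ 0 := by exact_mod_cast k.succ_ne_zero
  field_simp

theorem taylorSeries_scale (μ : ℂ) (F : ℂ → ℂ) :
    taylorSeries (fun z => μ⁻¹ * F (μ * z)) = C μ⁻¹ * rescale μ (taylorSeries F) := by
  have h (k : ℕ) : iteratedDeriv k (fun z => μ⁻¹ * F (μ * z)) =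
      fun z => μ⁻¹ * (μ ^ k * iteratedDeriv k F (μ * z)) := by
    induction k with
    | zero => simp
    | succ k ih =>
      rw [iteratedDeriv_succ, ih]
      funext z
      rw [deriv_const_mul_field, deriv_const_mul_field, deriv_comp_mul_left, iteratedDeriv_succ,
        smul_eq_mul, pow_succ, mul_assoc (μ ^ k)]
  ext k
  simp only [coeff_C_mul, coeff_rescale, taylorSeries, coeff_mk, h, mul_zero]
  ring

theorem coeff_zero_taylorSeries (F : ℂ → ℂ) : coeff 0 (taylorSeries F) = F 0 := by
  simp [taylorSeries, -coeff_zero_eq_constantCoeff]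

theorem coeff_one_taylorSeries (F : ℂ → ℂ) : coeff 1 (taylorSeries F) = deriv F 0 := by
  simp [taylorSeries]

end Taylor

/-! ### Zariski closed sets, and the two components of the variety -/

section Zariski

open MvPolynomial

theorem isClosed_zariski_iff {n : ℕ} {Z : Set (Fin n → ℂ)} :
    IsClosed[zariskiTopology n] Z ↔
      ∃ S : Set (MvPolynomial (Fin n) ℂ), Z = {x | ∀ p ∈ S, eval x p = 0} := by
  rw [← @isOpen_compl_iff _ _ (zariskiTopology n)]
  change Zᶜᶜ ∈ _ ↔ _
  rw [compl_compl]
  rfl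

theorem zariski_closure_eq {n : ℕ} {U B : Set (Fin n → ℂ)} (hB : IsClosed[zariskiTopology n] B)
    (hUB : U ⊆ B) (h : ∀ p : MvPolynomial (Fin n) ℂ, (∀ x ∈ U, eval x p = 0) →
      ∀ x ∈ B, eval x p = 0) : closure[zariskiTopology n] U = B := by
  let _ := zariskiTopology n
  refine Set.Subset.antisymm (closure_minimal hUB hB) ?_
  obtain ⟨S, hS⟩ := isClosed_zariski_iff.mp (isClosed_closure (s := U))
  rw [hS]
  intro x hx p hp
  refine h p (fun y hy => ?_) x hx
  have := subset_closure hy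
  rw [hS] at this
  exact this p hp

/-- The image of an affine space under a polynomial map is irreducible, since the polynomial ring
is a domain. -/
theorem isIrreducible_range_polynomial {m n : ℕ} (P : Fin n → MvPolynomial (Fin m) ℂ) :
    @IsIrreducible _ (zariskiTopology n) (Set.range fun x i => eval x (P i)) := by
  let _ := zariskiTopology n
  refine ⟨Set.range_nonempty _, ?_⟩
  rw [isPreirreducible_iff_isClosed_union_isClosed]
  intro Z₁ Z₂ h₁ h₂ hZ
  obtain ⟨S₁, rfl⟩ := isClosed_zariski_iff.mp h₁
  obtain ⟨S₂, rfl⟩ := isClosed_zariski_iff.mp h₂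
  by_contra! hcon
  obtain ⟨hn₁, hn₂⟩ := hcon
  obtain ⟨_, ⟨x₁, rfl⟩, hx₁⟩ := Set.not_subset.mp hn₁
  obtain ⟨_, ⟨x₂, rfl⟩, hx₂⟩ := Set.not_subset.mp hn₂
  simp only [Set.mem_ofPred_eq, not_forall] at hx₁ hx₂
  obtain ⟨p₁, hp₁, hx₁⟩ := hx₁
  obtain ⟨p₂, hp₂, hx₂⟩ := hx₂
  have hev (x : Fin m → ℂ) (p : MvPolynomial (Fin n) ℂ) :
      eval (fun i => eval x (P i)) p = eval x (bind₁ P p) :=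
    (eval₂Hom_bind₁ (RingHom.id ℂ) x P p).symm
  have hprod : bind₁ P p₁ * bind₁ P p₂ = 0 := by
    refine MvPolynomial.funext fun x => ?_
    rw [map_mul, ← hev, ← hev, map_zero]
    rcases hZ ⟨x, rfl⟩ with h | h
    · rw [h p₁ hp₁, zero_mul]
    · rw [h p₂ hp₂, mul_zero]
  rw [hev] at hx₁ hx₂
  rcases mul_eq_zero.mp hprod with h | h
  · exact hx₁ (by rw [h, map_zero])
  · exact hx₂ (by rw [h, map_zero])

theorem zariskiComponents_union {n : ℕ} {A B : Set (Fin n → ℂ)}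
    (hA : IsClosed[zariskiTopology n] A) (hB : IsClosed[zariskiTopology n] B)
    (hA' : @IsIrreducible _ (zariskiTopology n) A) (hB' : @IsIrreducible _ (zariskiTopology n) B)
    (hAB : ¬ A ⊆ B) (hBA : ¬ B ⊆ A) : zariskiComponents (A ∪ B) = {A, B} := by
  let _ := zariskiTopology n
  have hsub {W : Set (Fin n → ℂ)} (hW : W ⊆ A ∪ B) (hW' : IsIrreducible W) : W ⊆ A ∨ W ⊆ B :=
    isPreirreducible_iff_isClosed_union_isClosed.mp hW'.isPreirreducible A B hA hB hW
  ext Z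
  simp only [zariskiComponents, Set.mem_ofPred_eq, Set.mem_insert_iff, Set.mem_singleton_iff]
  constructor
  · intro hZ
    rcases hsub hZ.prop.1 hZ.prop.2 with h | h
    · exact Or.inl (hZ.eq_of_le ⟨Set.subset_union_left, hA'⟩ h)
    · exact Or.inr (hZ.eq_of_le ⟨Set.subset_union_right, hB'⟩ h)
  · rintro (rfl | rfl)
    · refine ⟨⟨Set.subset_union_left, hA'⟩, fun W hW hle => ?_⟩
      rcases hsub hW.1 hW.2 with h | h
      · exact h
      · exact absurd (hle.trans h) hAB
    · refine ⟨⟨Set.subset_union_right, hB'⟩, fun W hW hle => ?_⟩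
      rcases hsub hW.1 hW.2 with h | h
      · exact absurd (hle.trans h) hBA
      · exact h

/-- The plane `q₁ = q₃ = 0` in the space of parameters. -/
def evenPlane : Set (Fin 4 → ℂ) := {q | q 0 = 0 ∧ q 2 = 0}

/-- A weighted homogeneous parametrization of the component of `P₅ = P₆ = P₇ = 0` other than
`q₁ = q₃ = 0`. The equation `P₆ = 0` says that `(q₁ ^ 2 + q₂) / 2` is the square of the rational
function `t = (13 q₁ ^ 3 + 9 q₁ q₂ + 3 q₃) / (18 q₁ ^ 2)`, and `P₅ = 0` is linear in `q₄`. -/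
def surfaceMap (x t : ℂ) : Fin 4 → ℂ :=
  ![x, 2 * t ^ 2 - x ^ 2, 6 * t * x ^ 2 - 4 / 3 * x ^ 3 - 6 * t ^ 2 * x,
    13 / 15 * x ^ 4 + 52 / 5 * t ^ 2 * x ^ 2 + 14 / 5 * t ^ 4 - 24 / 5 * t * x ^ 3 -
      48 / 5 * t ^ 3 * x]

/-- The image of `surfaceMap`. -/
def surface : Set (Fin 4 → ℂ) := {q | ∃ x t : ℂ, q = surfaceMap x t}

theorem evenPlane_eq_range : evenPlane =
    Set.range fun (x : Fin 2 → ℂ) i =>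
      eval x ((![0, X 0, 0, X 1] : Fin 4 → MvPolynomial (Fin 2) ℂ) i) := by
  ext q
  constructor
  · rintro ⟨h0, h2⟩
    refine ⟨![q 1, q 3], funext fun i => ?_⟩
    fin_cases i <;> simp [h0, h2]
  · rintro ⟨x, rfl⟩
    exact ⟨by simp, by simp⟩

theorem isIrreducible_evenPlane : @IsIrreducible _ (zariskiTopology 4) evenPlane := by
  rw [evenPlane_eq_range]
  exact isIrreducible_range_polynomial _

theorem surface_eq_range : surface =
    Set.range fun (x : Fin 2 → ℂ) i =>
      eval x ((![X 0, 2 * X 1 ^ 2 - X 0 ^ 2,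
        6 * X 1 * X 0 ^ 2 - C (4 / 3) * X 0 ^ 3 - 6 * X 1 ^ 2 * X 0,
        C (13 / 15) * X 0 ^ 4 + C (52 / 5) * X 1 ^ 2 * X 0 ^ 2 + C (14 / 5) * X 1 ^ 4 -
          C (24 / 5) * X 1 * X 0 ^ 3 - C (48 / 5) * X 1 ^ 3 * X 0] :
        Fin 4 → MvPolynomial (Fin 2) ℂ) i) := by
  ext q
  constructor
  · rintro ⟨x, t, rfl⟩
    refine ⟨![x, t], funext fun i => ?_⟩
    fin_cases i <;> simp [surfaceMap]
  · rintro ⟨x, rfl⟩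
    refine ⟨x 0, x 1, funext fun i => ?_⟩
    fin_cases i <;> simp [surfaceMap]

theorem isIrreducible_surface : @IsIrreducible _ (zariskiTopology 4) surface := by
  rw [surface_eq_range]
  exact isIrreducible_range_polynomial _

theorem isClosed_evenPlane : IsClosed[zariskiTopology 4] evenPlane :=
  isClosed_zariski_iff.mpr ⟨{X 0, X 2}, by ext q; simp [evenPlane]⟩

theorem mem_surface_of_ne_zero {q : Fin 4 → ℂ} (h0 : q 0 ≠ 0)
    (h5 : P5 (q 0) (q 1) (q 2) (q 3) = 0) (h6 : P6 (q 0) (q 1) (q 2) = 0) : q ∈ surface := by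
  unfold P5 at h5
  unfold P6 at h6
  obtain ⟨t, ht⟩ : ∃ t, 18 * q 0 ^ 2 * t = 13 * q 0 ^ 3 + 9 * q 0 * q 1 + 3 * q 2 :=
    ⟨(13 * q 0 ^ 3 + 9 * q 0 * q 1 + 3 * q 2) / (18 * q 0 ^ 2), by field_simp⟩
  have ht2 : q 1 = 2 * t ^ 2 - q 0 ^ 2 := by
    apply mul_left_cancel₀ (pow_ne_zero 4 h0)
    rw [← ht] at h6
    linear_combination -1 / 162 * h6
  have hq2 : q 2 = 6 * t * q 0 ^ 2 - 4 / 3 * q 0 ^ 3 - 6 * t ^ 2 * q 0 := by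
    linear_combination -1 / 3 * ht - 3 * q 0 * ht2
  have hq3 : q 3 = 13 / 15 * q 0 ^ 4 + 52 / 5 * t ^ 2 * q 0 ^ 2 + 14 / 5 * t ^ 4 -
      24 / 5 * t * q 0 ^ 3 - 48 / 5 * t ^ 3 * q 0 := by
    apply mul_left_cancel₀ h0
    rw [hq2, ht2] at h5
    linear_combination 1 / 30 * h5
  refine ⟨q 0, t, funext fun i => ?_⟩
  fin_cases i
  · rfl
  · exact ht2
  · exact hq2
  · exact hq3

/-- Besides `P₅ = P₆ = 0`, the surface satisfies the equation obtained by eliminating `t` from the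
formula for `q₄` with the help of `2 t ^ 2 = q₁ ^ 2 + q₂`; it pins down `q₄` where `q₁ = 0`. -/
theorem isClosed_surface : IsClosed[zariskiTopology 4] surface := by
  let p5 : MvPolynomial (Fin 4) ℂ := 5 * X 0 ^ 5 + 50 * X 0 ^ 3 * X 1 + 51 * X 0 * X 1 ^ 2 +
    48 * X 0 ^ 2 * X 2 + 24 * X 1 * X 2 + 30 * X 0 * X 3
  let p6 : MvPolynomial (Fin 4) ℂ := (13 * X 0 ^ 3 + 9 * X 0 * X 1 + 3 * X 2) ^ 2 -
    162 * X 0 ^ 4 * (X 0 ^ 2 + X 1)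
  let p8 : MvPolynomial (Fin 4) ℂ := 2 * (X 3 - C (13 / 15) * X 0 ^ 4 -
    C (26 / 5) * (X 0 ^ 2 + X 1) * X 0 ^ 2 - C (7 / 10) * (X 0 ^ 2 + X 1) ^ 2) ^ 2 -
    X 0 ^ 2 * (X 0 ^ 2 + X 1) * (C (24 / 5) * (2 * X 0 ^ 2 + X 1)) ^ 2
  refine isClosed_zariski_iff.mpr ⟨{p5, p6, p8}, ?_⟩
  ext q
  simp only [Set.mem_insert_iff, Set.mem_singleton_iff, forall_eq_or_imp, forall_eq,
    Set.mem_ofPred_eq]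
  have e5 : eval q p5 = P5 (q 0) (q 1) (q 2) (q 3) := by simp [p5, P5]
  have e6 : eval q p6 = P6 (q 0) (q 1) (q 2) := by simp [p6, P6]
  have e8 : eval q p8 = 2 * (q 3 - 13 / 15 * q 0 ^ 4 - 26 / 5 * (q 0 ^ 2 + q 1) * q 0 ^ 2 -
      7 / 10 * (q 0 ^ 2 + q 1) ^ 2) ^ 2 -
      q 0 ^ 2 * (q 0 ^ 2 + q 1) * (24 / 5 * (2 * q 0 ^ 2 + q 1)) ^ 2 := by
    simp [p8]
  rw [e5, e6, e8]
  constructor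
  · rintro ⟨x, t, rfl⟩
    simp only [P5, P6, surfaceMap, Matrix.cons_val]
    refine ⟨by ring, by ring, by ring⟩
  · rintro ⟨h5, h6, h8⟩
    by_cases h0 : q 0 = 0
    · obtain ⟨t, ht⟩ := IsAlgClosed.exists_pow_nat_eq (q 1 / 2) two_pos
      have h2 : q 2 = 0 := by
        simpa [P6, h0] using h6
      have h3 : q 3 - 7 / 10 * q 1 ^ 2 = 0 := by
        simpa [h0] using h8
      refine ⟨0, t, funext fun i => ?_⟩
      have ht' : q 1 = 2 * t ^ 2 := by rw [ht]; ring
      fin_cases i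
      · exact h0
      · simp [surfaceMap, ht']
      · simp [surfaceMap, h2]
      · simp only [surfaceMap, Fin.reduceFinMk, Matrix.cons_val]
        rw [ht'] at h3
        linear_combination h3
    · exact mem_surface_of_ne_zero h0 h5 h6

theorem V567_eq : V567 = evenPlane ∪ surface := by
  ext q
  constructor
  · rintro ⟨h5, h6, h7⟩
    by_cases h0 : q 0 = 0
    · exact Or.inl ⟨h0, by simpa [P6, h0] using h6⟩
    · exact Or.inr (mem_surface_of_ne_zero h0 h5 h6)
  · rintro (⟨h0, h2⟩ | ⟨x, t, rfl⟩)
    · simp [V567, P5, P6, P7, h0, h2]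
    · simp only [V567, P5, P6, P7, surfaceMap, Set.mem_ofPred_eq, Matrix.cons_val]
      refine ⟨by ring, by ring, by ring⟩

theorem zariskiComponents_V567 : zariskiComponents V567 = {evenPlane, surface} := by
  rw [V567_eq]
  refine zariskiComponents_union isClosed_evenPlane isClosed_surface isIrreducible_evenPlane
    isIrreducible_surface (fun h => ?_) (fun h => ?_)
  · obtain ⟨x, t, hx⟩ := h (show ![0, 0, 0, 1] ∈ evenPlane from ⟨rfl, rfl⟩)
    have h0 : (0 : ℂ) = x := congrFun hx 0
    have h1 : (0 : ℂ) = 2 * t ^ 2 - x ^ 2 := congrFun hx 1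
    have h3 : (1 : ℂ) = 13 / 15 * x ^ 4 + 52 / 5 * t ^ 2 * x ^ 2 + 14 / 5 * t ^ 4 -
      24 / 5 * t * x ^ 3 - 48 / 5 * t ^ 3 * x := congrFun hx 3
    subst h0
    have ht : t = 0 := by simpa using h1
    rw [ht] at h3
    norm_num at h3
  · have := (h (show surfaceMap 1 0 ∈ surface from ⟨1, 0, rfl⟩)).1
    simp [surfaceMap] at this

end Zariski

/-! ### Polynomial Pell equations -/

section Pell

open Polynomial

theorem Polynomial.Monic.eq_quadratic {p : ℂ[X]} (hp : p.Monic) (hd : p.natDegree = 2) :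
    p = X ^ 2 + C (p.coeff 1) * X + C (p.coeff 0) := by
  conv_lhs => rw [hp.as_sum, hd]
  simp [Finset.sum_range_succ]
  ring

/-- A factorization of the monic solution of a Pell equation `R T ^ 2 = A B` with `A` and `B`
coprime: the square `T ^ 2` is distributed among the two coprime factors. -/
theorem exists_factorization_of_pell {R T A B : ℂ[X]} (hR : R.Monic) (hT : T.Monic) (hA : A.Monic)
    (hAB : IsCoprime A B) (h : R * T ^ 2 = A * B) :
    ∃ R₁ R₂ T₁ T₂ : ℂ[X], R₁.Monic ∧ R₂.Monic ∧ T₁.Monic ∧ T₂.Monic ∧ R = R₁ * R₂ ∧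
      T = T₁ * T₂ ∧ A = R₁ * T₁ ^ 2 ∧ B = R₂ * T₂ ^ 2 := by
  have hB : B.Monic := by
    have : (A * B).Monic := h ▸ hR.mul (hT.pow 2)
    exact hA.of_mul_monic_left this
  obtain ⟨d₁, d₂, hd₁, hd₂, hd⟩ := exists_dvd_and_dvd_of_dvd_mul (Dvd.intro_left R h)
  have hcop : IsCoprime d₁ d₂ := (hAB.of_isCoprime_of_dvd_left hd₁).of_isCoprime_of_dvd_right hd₂
  obtain ⟨e₁, he₁⟩ := exists_associated_pow_of_mul_eq_pow' hcop hd.symm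
  obtain ⟨e₂, he₂⟩ := exists_associated_pow_of_mul_eq_pow' hcop.symm ((mul_comm _ _).trans hd.symm)
  have hd0 : d₁ * d₂ ≠ 0 := hd ▸ (hT.pow 2).ne_zero
  have he₁0 : e₁ ≠ 0 := by
    rintro rfl
    have := he₁.eq_zero_iff.mp (by simp)
    simp [this] at hd0
  have he₂0 : e₂ ≠ 0 := by
    rintro rfl
    have := he₂.eq_zero_iff.mp (by simp)
    simp [this] at hd0
  have hm₁ : (normalize e₁).Monic := monic_normalize he₁0
  have hm₂ : (normalize e₂).Monic := monic_normalize he₂0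
  have ha₁ : Associated ((normalize e₁) ^ 2) d₁ := ((normalize_associated e₁).pow_pow).trans he₁
  have ha₂ : Associated ((normalize e₂) ^ 2) d₂ := ((normalize_associated e₂).pow_pow).trans he₂
  set T₁ := normalize e₁
  set T₂ := normalize e₂
  have hsq : T₁ ^ 2 * T₂ ^ 2 = T ^ 2 := by
    refine eq_of_monic_of_associated ((hm₁.pow 2).mul (hm₂.pow 2)) (hT.pow 2) ?_
    rw [hd]
    exact ha₁.mul_mul ha₂
  have hT12 : T = T₁ * T₂ := by
    have : (T - T₁ * T₂) * (T + T₁ * T₂) = 0 := by linear_combination -hsq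
    rcases mul_eq_zero.mp this with h | h
    · exact sub_eq_zero.mp h
    · exfalso
      have h1 := congrArg leadingCoeff (eq_neg_of_add_eq_zero_left h)
      rw [hT.leadingCoeff, leadingCoeff_neg, (hm₁.mul hm₂).leadingCoeff] at h1
      norm_num at h1
  obtain ⟨R₁, hR₁⟩ := ha₁.dvd.trans hd₁
  obtain ⟨R₂, hR₂⟩ := ha₂.dvd.trans hd₂
  refine ⟨R₁, R₂, T₁, T₂, ?_, ?_, hm₁, hm₂, ?_, hT12, by rw [hR₁, mul_comm], by rw [hR₂, mul_comm]⟩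
  · exact (hm₁.pow 2).of_mul_monic_left (hR₁ ▸ hA)
  · exact (hm₂.pow 2).of_mul_monic_left (hR₂ ▸ hB)
  · apply mul_right_cancel₀ (hT.pow 2).ne_zero
    rw [h, hR₁, hR₂, hT12]
    ring

theorem isCoprime_sub_C {A : ℂ[X]} {c : ℂ} (hc : c ≠ 0) : IsCoprime A (A - C c) := by
  refine ⟨C c⁻¹, -C c⁻¹, ?_⟩
  have : C c⁻¹ * C c = (1 : ℂ[X]) := by rw [← C_mul, inv_mul_cancel₀ hc, C_1]
  linear_combination this

/-- In degree six, when neither factor is a square, parity of degrees shows that both `R` and `T`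
split into two quadratic polynomials, and the coefficients of the factors of `R` satisfy two cubic
relations. -/
theorem exists_quadratic_factors_of_pell {R T A : ℂ[X]} {c : ℂ} (hc : c ≠ 0) (hR : R.Monic)
    (hR4 : R.natDegree = 4) (hT : T.Monic) (hA : A.Monic) (hA6 : A.natDegree = 6)
    (h : R * T ^ 2 = A * (A - C c)) (hd : derivative A = 6 * X * T) (h₁ : ¬ ∃ S, A = S ^ 2)
    (h₂ : ¬ ∃ S, A - C c = S ^ 2) :
    ∃ a₁ b₁ a₂ b₂ : ℂ, R = (X ^ 2 + C a₁ * X + C b₁) * (X ^ 2 + C a₂ * X + C b₂) ∧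
      a₁ * (a₁ ^ 2 + 6 * a₁ * a₂ + 3 * a₂ ^ 2) + 12 * a₁ * b₁ + 4 * a₁ * b₂ + 16 * a₂ * b₁ = 0 ∧
      a₂ * (a₂ ^ 2 + 6 * a₂ * a₁ + 3 * a₁ ^ 2) + 12 * a₂ * b₂ + 4 * a₂ * b₁ + 16 * a₁ * b₂ = 0 := by
  obtain ⟨R₁, R₂, T₁, T₂, mR₁, mR₂, mT₁, mT₂, hR12, hT12, e₁, e₂⟩ :=
    exists_factorization_of_pell hR hT hA (isCoprime_sub_C hc) h
  have n₁ : R₁.natDegree + 2 * T₁.natDegree = 6 := by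
    rw [← hA6, e₁, mR₁.natDegree_mul (mT₁.pow 2), mT₁.natDegree_pow]
  have n₂ : R₂.natDegree + 2 * T₂.natDegree = 6 := by
    rw [← hA6, ← natDegree_sub_C (p := A) (a := c), e₂, mR₂.natDegree_mul (mT₂.pow 2),
      mT₂.natDegree_pow]
  have n₃ : R₁.natDegree + R₂.natDegree = 4 := by
    rw [← hR4, hR12, mR₁.natDegree_mul mR₂]
  have p₁ : R₁.natDegree ≠ 0 := fun h0 => h₁ ⟨T₁, by
    rw [e₁, eq_one_of_monic_natDegree_zero mR₁ h0, one_mul]⟩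
  have p₂ : R₂.natDegree ≠ 0 := fun h0 => h₂ ⟨T₂, by
    rw [e₂, eq_one_of_monic_natDegree_zero mR₂ h0, one_mul]⟩
  have d₁ : derivative R₁ * T₁ + 2 * R₁ * derivative T₁ = 6 * X * T₂ := by
    apply mul_right_cancel₀ mT₁.ne_zero
    rw [e₁, hT12, derivative_mul, derivative_pow] at hd
    simp only [Nat.cast_ofNat, map_ofNat] at hd
    linear_combination hd
  have d₂ : derivative R₂ * T₂ + 2 * R₂ * derivative T₂ = 6 * X * T₁ := by
    apply mul_right_cancel₀ mT₂.ne_zero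
    have hd' : derivative (A - C c) = 6 * X * T := by rw [derivative_sub, derivative_C, sub_zero, hd]
    rw [e₂, hT12, derivative_mul, derivative_pow] at hd'
    simp only [Nat.cast_ofNat, map_ofNat] at hd'
    linear_combination hd'
  have qR₁ := mR₁.eq_quadratic (by omega)
  have qR₂ := mR₂.eq_quadratic (by omega)
  have qT₁ := mT₁.eq_quadratic (by omega)
  have qT₂ := mT₂.eq_quadratic (by omega)
  generalize R₁.coeff 1 = a₁, R₁.coeff 0 = b₁ at qR₁
  generalize R₂.coeff 1 = a₂, R₂.coeff 0 = b₂ at qR₂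
  generalize T₁.coeff 1 = c₁, T₁.coeff 0 = g₁ at qT₁
  generalize T₂.coeff 1 = c₂, T₂.coeff 0 = g₂ at qT₂
  refine ⟨a₁, b₁, a₂, b₂, by rw [hR12, qR₁, qR₂], ?_⟩
  rw [qR₁, qT₁, qT₂] at d₁
  rw [qR₂, qT₂, qT₁] at d₂
  have k₁ (x : ℂ) := congrArg (eval x) d₁
  have k₂ (x : ℂ) := congrArg (eval x) d₂
  simp at k₁ k₂
  have u0 := k₁ 0
  have u1 := k₁ 1
  have u2 := k₁ (-1)
  have v0 := k₂ 0
  have v1 := k₂ 1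
  have v2 := k₂ (-1)
  clear k₁ k₂
  have hc₁ : c₁ = a₁ + 3 / 2 * a₂ := by
    linear_combination -1 / 10 * (u1 + u2 - 2 * u0) - 3 / 20 * (v1 + v2 - 2 * v0)
  have hc₂ : c₂ = a₂ + 3 / 2 * a₁ := by
    linear_combination -1 / 10 * (v1 + v2 - 2 * v0) - 3 / 20 * (u1 + u2 - 2 * u0)
  subst hc₁ hc₂
  have hg₁ : 16 * g₁ = (3 * a₁ ^ 2 + 9 / 2 * a₁ * a₂ + 4 * b₁) +
      3 * (3 * a₂ ^ 2 + 9 / 2 * a₁ * a₂ + 4 * b₂) := by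
    linear_combination -1 / 2 * (u1 - u2) - 3 / 2 * (v1 - v2)
  have hg₂ : 16 * g₂ = (3 * a₂ ^ 2 + 9 / 2 * a₁ * a₂ + 4 * b₂) +
      3 * (3 * a₁ ^ 2 + 9 / 2 * a₁ * a₂ + 4 * b₁) := by
    linear_combination -1 / 2 * (v1 - v2) - 3 / 2 * (u1 - u2)
  constructor
  · linear_combination 16 / 3 * u0 - 1 / 3 * a₁ * hg₁
  · linear_combination 16 / 3 * v0 - 1 / 3 * a₂ * hg₂

/-- If `a₁ + a₂ ≠ 0` the two relations determine `b₁` and `b₂`, and the parameter of the surface is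
`t = (2 s ^ 2 + a₁ a₂) / (12 s)` with `s = a₁ + a₂ = 4 q₁`. -/
theorem mem_surface_or_mem_evenPlane {a₁ b₁ a₂ b₂ : ℂ} {q : Fin 4 → ℂ}
    (e₁ : a₁ * (a₁ ^ 2 + 6 * a₁ * a₂ + 3 * a₂ ^ 2) + 12 * a₁ * b₁ + 4 * a₁ * b₂ +
      16 * a₂ * b₁ = 0)
    (e₂ : a₂ * (a₂ ^ 2 + 6 * a₂ * a₁ + 3 * a₁ ^ 2) + 12 * a₂ * b₂ + 4 * a₂ * b₁ +
      16 * a₁ * b₂ = 0)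
    (h3 : 4 * q 0 = a₁ + a₂) (h2 : 12 * q 1 = b₁ + b₂ + a₁ * a₂)
    (h1 : 24 * q 2 = a₁ * b₂ + a₂ * b₁)
    (h0 : 40 * q 3 - 16 * q 0 * q 2 + 8 * q 1 ^ 2 = b₁ * b₂) :
    (q 0 ≠ 0 ∧ q ∈ surface) ∨ q ∈ evenPlane := by
  by_cases hs : a₁ + a₂ = 0
  · right
    have ha₂ : a₂ = -a₁ := by linear_combination hs
    subst ha₂
    have ha : a₁ ^ 3 = 0 := by linear_combination -1 / 4 * e₁ + 1 / 4 * e₂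
    have ha : a₁ = 0 := by simpa using ha
    subst ha
    exact ⟨by linear_combination 1 / 4 * h3, by linear_combination 1 / 24 * h1⟩
  · left
    have hq0 : q 0 = (a₁ + a₂) / 4 := by linear_combination 1 / 4 * h3
    have hb₁ : b₁ = -a₁ * (a₁ ^ 3 + 6 * a₁ ^ 2 * a₂ + 6 * a₁ * a₂ ^ 2 + 2 * a₂ ^ 3) /
        (12 * (a₁ + a₂) ^ 2) := by
      field_simp
      linear_combination 1 / 4 * ((3 * a₂ + 4 * a₁) * e₁ - a₁ * e₂)
    have hb₂ : b₂ = -a₂ * (a₂ ^ 3 + 6 * a₂ ^ 2 * a₁ + 6 * a₂ * a₁ ^ 2 + 2 * a₁ ^ 3) /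
        (12 * (a₁ + a₂) ^ 2) := by
      field_simp
      linear_combination 1 / 4 * ((3 * a₁ + 4 * a₂) * e₂ - a₂ * e₁)
    have hq1 : q 1 = 2 * ((2 * (a₁ + a₂) ^ 2 + a₁ * a₂) / (12 * (a₁ + a₂))) ^ 2 -
        ((a₁ + a₂) / 4) ^ 2 := by
      have : q 1 = (b₁ + b₂ + a₁ * a₂) / 12 := by linear_combination 1 / 12 * h2
      rw [this, hb₁, hb₂]
      field_simp
      ring
    have hq2 : q 2 = surfaceMap ((a₁ + a₂) / 4)
        ((2 * (a₁ + a₂) ^ 2 + a₁ * a₂) / (12 * (a₁ + a₂))) 2 := by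
      have : q 2 = (a₁ * b₂ + a₂ * b₁) / 24 := by linear_combination 1 / 24 * h1
      rw [this, hb₁, hb₂]
      simp only [surfaceMap, Matrix.cons_val]
      field_simp
      ring
    have hq3 : q 3 = surfaceMap ((a₁ + a₂) / 4)
        ((2 * (a₁ + a₂) ^ 2 + a₁ * a₂) / (12 * (a₁ + a₂))) 3 := by
      have : q 3 = (b₁ * b₂ + 16 * q 0 * q 2 - 8 * q 1 ^ 2) / 40 := by
        linear_combination 1 / 40 * h0
      rw [this, hq1, hq2, hq0, hb₁, hb₂]
      simp only [surfaceMap, Matrix.cons_val]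
      field_simp
      ring
    refine ⟨by rw [hq0]; simpa using hs, (a₁ + a₂) / 4,
      (2 * (a₁ + a₂) ^ 2 + a₁ * a₂) / (12 * (a₁ + a₂)), funext fun i => ?_⟩
    fin_cases i
    · exact hq0
    · exact hq1
    · exact hq2
    · exact hq3

end Pell

/-! ### Elliptic functions with two poles -/

section Elliptic

open Filter Set Polynomial

/-- The complement of the cosets `L` and `ρ + L`. -/
def regularSet (L : PeriodPair) (ρ : ℂ) : Set ℂ := {z | z ∉ L.lattice ∧ z - ρ ∉ L.lattice}

variable {L : PeriodPair} {ρ : ℂ}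

theorem eventually_mem_regularSet (p : ℂ) : ∀ᶠ z in 𝓝[≠] p, z ∈ regularSet L ρ := by
  have h1 : ∀ᶠ z in 𝓝[≠] p, z ∉ L.lattice := by
    filter_upwards [nhdsWithin_le_nhds (L.compl_lattice_sdiff_singleton_mem_nhds p),
      self_mem_nhdsWithin] with z hz hz' hmem
    exact hz ⟨hmem, hz'⟩
  have h2 : ∀ᶠ z in 𝓝[≠] p, z - ρ ∉ L.lattice := by
    have ht : Tendsto (fun z => z - ρ) (𝓝 p) (𝓝 (p - ρ)) := by
      exact (continuous_id.sub continuous_const).tendsto p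
    filter_upwards [nhdsWithin_le_nhds
      (ht (L.compl_lattice_sdiff_singleton_mem_nhds (p - ρ))), self_mem_nhdsWithin] with z hz hz' hmem
    exact hz ⟨hmem, fun h => hz' (sub_left_injective h)⟩
  exact h1.and h2

theorem isOpen_regularSet : IsOpen (regularSet L ρ) := by
  refine IsOpen.and L.isClosed_lattice.isOpen_compl ?_
  exact L.isClosed_lattice.isOpen_compl.preimage (continuous_id.sub continuous_const)

theorem countable_compl_regularSet : (regularSet L ρ)ᶜ.Countable := by
  have hc : (L.lattice : Set ℂ).Countable := Set.countable_coe_iff.mp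
    (inferInstanceAs (Countable L.lattice))
  refine (hc.union (hc.image fun z => z + ρ)).mono fun z hz => ?_
  by_contra hcon
  rw [mem_union, not_or] at hcon
  exact hz ⟨hcon.1, fun h => hcon.2 ⟨_, h, by ring⟩⟩

theorem isPreconnected_regularSet : IsPreconnected (regularSet L ρ) := by
  have := Set.Countable.isConnected_compl_of_one_lt_rank (E := ℂ) (by simp)
    (countable_compl_regularSet (L := L) (ρ := ρ))
  rw [compl_compl] at this
  exact this.isPreconnected

theorem add_mem_regularSet {z ω : ℂ} (hz : z ∈ regularSet L ρ) (hω : ω ∈ L.lattice) :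
    z + ω ∈ regularSet L ρ := by
  refine ⟨fun h => hz.1 (by simpa using L.lattice.sub_mem h hω), fun h => hz.2 ?_⟩
  have := L.lattice.sub_mem h hω
  rwa [show z + ω - ρ - ω = z - ρ by ring] at this

theorem sub_mem_regularSet {z : ℂ} (hz : z ∈ regularSet L ρ) : ρ - z ∈ regularSet L ρ := by
  refine ⟨fun h => hz.2 ?_, fun h => hz.1 ?_⟩
  · rw [← neg_sub]; exact L.lattice.neg_mem h
  · have := L.lattice.neg_mem h
    rwa [show -(ρ - z - ρ) = z by ring] at this

/-- A function without poles that is periodic with respect to a lattice is constant. -/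
theorem eq_const_of_periodic_of_removable {h : ℂ → ℂ} (hd : DifferentiableOn ℂ h (regularSet L ρ))
    (hp : ∀ z ∈ regularSet L ρ, ∀ ω ∈ L.lattice, h (z + ω) = h z)
    (h0 : ∃ g, AnalyticAt ℂ g 0 ∧ ∀ᶠ z in 𝓝[≠] 0, h z = g z)
    (hρ : ∃ g, AnalyticAt ℂ g ρ ∧ ∀ᶠ z in 𝓝[≠] ρ, h z = g z) :
    ∃ c, ∀ z ∈ regularSet L ρ, h z = c := by
  have htrans {a p : ℂ} (ha : ∃ g, AnalyticAt ℂ g a ∧ ∀ᶠ z in 𝓝[≠] a, h z = g z)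
      (hpa : p - a ∈ L.lattice) : ∃ g, AnalyticAt ℂ g p ∧ ∀ᶠ z in 𝓝[≠] p, h z = g z := by
    obtain ⟨g, hg, hhg⟩ := ha
    refine ⟨fun z => g (z - (p - a)), ?_, ?_⟩
    · refine AnalyticAt.comp (g := g) (f := fun z => z - (p - a)) ?_ (by fun_prop)
      simpa using hg
    · have ht : Tendsto (fun z => z - (p - a)) (𝓝[≠] p) (𝓝[≠] a) := by
        refine tendsto_nhdsWithin_iff.mpr ⟨?_, ?_⟩
        · have : Tendsto (fun z => z - (p - a)) (𝓝 p) (𝓝 (p - (p - a))) := by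
            exact (continuous_id.sub continuous_const).tendsto p
          rw [sub_sub_cancel] at this
          exact this.mono_left nhdsWithin_le_nhds
        · filter_upwards [self_mem_nhdsWithin] with z hz hza
          apply hz
          have : z - (p - a) = a := hza
          simp only [mem_singleton_iff]
          linear_combination this
      filter_upwards [ht.eventually hhg, eventually_mem_regularSet p] with z hz hzΩ
      have := hp _ (add_mem_regularSet hzΩ (L.lattice.neg_mem hpa)) _ hpa
      rw [← hz, ← sub_eq_add_neg] at *
      rw [← this, sub_add_cancel]
  have hex (p : ℂ) : ∃ g, AnalyticAt ℂ g p ∧ ∀ᶠ z in 𝓝[≠] p, h z = g z := by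
    by_cases h1 : p ∈ L.lattice
    · exact htrans h0 (by simpa using h1)
    by_cases h2 : p - ρ ∈ L.lattice
    · exact htrans hρ h2
    · exact ⟨h, hd.analyticAt (isOpen_regularSet.mem_nhds ⟨h1, h2⟩), .of_forall fun _ => rfl⟩
  choose g hg hhg using hex
  -- the entire extension of `h`
  set H : ℂ → ℂ := fun p => g p p with hH
  have hHlim (p : ℂ) {k : ℂ → ℂ} (hk : ContinuousAt k p) (hhk : ∀ᶠ z in 𝓝[≠] p, h z = k z) :
      H p = k p := by
    have t1 : Tendsto h (𝓝[≠] p) (𝓝 (g p p)) :=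
      ((hg p).continuousAt.tendsto.mono_left nhdsWithin_le_nhds).congr'
        ((hhg p).mono fun z hz => hz.symm)
    have t2 : Tendsto h (𝓝[≠] p) (𝓝 (k p)) :=
      (hk.tendsto.mono_left nhdsWithin_le_nhds).congr' (hhk.mono fun z hz => hz.symm)
    exact tendsto_nhds_unique t1 t2
  have hHh {p : ℂ} (hpΩ : p ∈ regularSet L ρ) : H p = h p :=
    hHlim p (hd.differentiableAt (isOpen_regularSet.mem_nhds hpΩ)).continuousAt
      (.of_forall fun _ => rfl)
  have hHan (p : ℂ) : AnalyticAt ℂ H p := by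
    refine (hg p).congr ?_
    have e1 : ∀ᶠ z in 𝓝[≠] p, g p z = H z := by
      filter_upwards [hhg p, eventually_mem_regularSet p] with z hz hzΩ
      rw [hHh hzΩ, hz]
    rw [eventually_nhdsWithin_iff] at e1
    filter_upwards [e1] with z hz
    by_cases hzp : z = p
    · rw [hzp]
    · exact hz hzp
  have hHcont : Continuous H := continuous_iff_continuousAt.mpr fun p => (hHan p).continuousAt
  have hHper (z : ℂ) {ω : ℂ} (hω : ω ∈ L.lattice) : H (z + ω) = H z := by
    have t1 : Tendsto (fun w => H (w + ω) - H w) (𝓝[≠] z) (𝓝 (H (z + ω) - H z)) :=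
      ((hHcont.comp (continuous_id.add continuous_const)).sub hHcont).continuousAt.tendsto.mono_left
        nhdsWithin_le_nhds
    have t2 : Tendsto (fun w => H (w + ω) - H w) (𝓝[≠] z) (𝓝 0) := by
      refine tendsto_const_nhds.congr' ?_
      filter_upwards [eventually_mem_regularSet z] with w hw
      rw [hHh hw, hHh (add_mem_regularSet hw hω), hp w hw ω hω, sub_self]
    exact sub_eq_zero.mp (tendsto_nhds_unique t1 t2)
  have hHd : Differentiable ℂ H := fun p => (hHan p).differentiableAt
  have hbd : Bornology.IsBounded (range H) :=
    (IsZLattice.isCompact_range_of_periodic L.lattice H hHcont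
      fun z ω hω => hHper z hω).isBounded
  exact ⟨H 0, fun z hz => by rw [← hHh hz]; exact hHd.apply_eq_apply_of_bounded hbd z 0⟩

/-- The elliptic functions that are invariant under `z ↦ ρ - z` and have no poles outside
`L ∪ (ρ + L)`. Their values on `L ∪ (ρ + L)` are left free. -/
structure IsSymmElliptic (L : PeriodPair) (ρ : ℂ) (h : ℂ → ℂ) : Prop where
  differentiableOn : DifferentiableOn ℂ h (regularSet L ρ)
  periodic : ∀ z ∈ regularSet L ρ, ∀ ω ∈ L.lattice, h (z + ω) = h z
  symm : ∀ z ∈ regularSet L ρ, h (ρ - z) = h z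

/-- The function `z ^ n h (z)` extends analytically to the origin, with value `a` there. -/
def HasPoleLE (h : ℂ → ℂ) (n : ℕ) (a : ℂ) : Prop :=
  ∃ k, AnalyticAt ℂ k 0 ∧ k 0 = a ∧ ∀ᶠ z in 𝓝[≠] (0 : ℂ), z ^ n * h z = k z

theorem exists_eq_mul_of_apply_zero {k : ℂ → ℂ} (hk : AnalyticAt ℂ k 0) (h0 : k 0 = 0) :
    ∃ g, AnalyticAt ℂ g 0 ∧ ∀ᶠ z in 𝓝 (0 : ℂ), k z = z * g z := by
  have h1 : ((1 : ℕ) : ℕ∞) ≤ analyticOrderAt k 0 := by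
    rw [Nat.cast_one, Order.one_le_iff_ne_zero]
    exact hk.analyticOrderAt_ne_zero.mpr h0
  obtain ⟨g, hg, hkg⟩ := (natCast_le_analyticOrderAt hk).mp h1
  exact ⟨g, hg, by simpa using hkg⟩

theorem IsSymmElliptic.eq_const {h : ℂ → ℂ} (hh : IsSymmElliptic L ρ h) {a : ℂ}
    (h0 : HasPoleLE h 0 a) : ∀ z ∈ regularSet L ρ, h z = a := by
  obtain ⟨k, hk, hka, hhk⟩ := h0
  simp only [pow_zero, one_mul] at hhk
  have hkρ : AnalyticAt ℂ (fun z => k (ρ - z)) ρ := by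
    refine AnalyticAt.comp (g := k) (f := fun z => ρ - z) ?_ (by fun_prop)
    simpa using hk
  have hhρ : ∀ᶠ z in 𝓝[≠] ρ, h z = k (ρ - z) := by
    have ht : Tendsto (fun z => ρ - z) (𝓝[≠] ρ) (𝓝[≠] 0) := by
      refine tendsto_nhdsWithin_iff.mpr ⟨?_, ?_⟩
      · have : Tendsto (fun z => ρ - z) (𝓝 ρ) (𝓝 (ρ - ρ)) :=
          (continuous_const.sub continuous_id).tendsto ρ
        rw [sub_self] at this
        exact this.mono_left nhdsWithin_le_nhds
      · filter_upwards [self_mem_nhdsWithin] with z hz hza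
        exact hz (sub_eq_zero.mp hza).symm
    filter_upwards [ht.eventually hhk, eventually_mem_regularSet ρ] with z hz hzΩ
    rw [← hz, hh.symm z hzΩ]
  obtain ⟨c, hc⟩ := eq_const_of_periodic_of_removable hh.differentiableOn hh.periodic
    ⟨k, hk, hhk⟩ ⟨_, hkρ, hhρ⟩
  have : c = a := by
    rw [← hka]
    refine tendsto_nhds_unique (f := h) (l := 𝓝[≠] (0 : ℂ)) ?_ ?_
    · refine tendsto_const_nhds.congr' ?_
      filter_upwards [eventually_mem_regularSet 0] with z hz
      exact (hc z hz).symm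
    · exact (hk.continuousAt.tendsto.mono_left nhdsWithin_le_nhds).congr'
        (hhk.mono fun z hz => hz.symm)
  rwa [this] at hc

/-- A symmetric elliptic function with a pole of order at most `n` at the origin is a polynomial of
degree at most `n` in a symmetric elliptic function with a simple pole there. -/
theorem IsSymmElliptic.exists_polynomial {u : ℂ → ℂ} (hu : IsSymmElliptic L ρ u)
    (hu1 : HasPoleLE u 1 1) (n : ℕ) {h : ℂ → ℂ} (hh : IsSymmElliptic L ρ h) {a : ℂ}
    (ha : HasPoleLE h n a) :
    ∃ P : ℂ[X], P.natDegree ≤ n ∧ P.coeff n = a ∧ ∀ z ∈ regularSet L ρ, h z = P.eval (u z) := by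
  induction n generalizing h a with
  | zero => exact ⟨C a, by simp, by simp, fun z hz => by rw [hh.eq_const ha z hz, eval_C]⟩
  | succ n ih =>
    obtain ⟨k, hk, hka, hhk⟩ := ha
    obtain ⟨e, he, he1, hue⟩ := hu1
    obtain ⟨g, hg, hkg⟩ := exists_eq_mul_of_apply_zero (k := fun z => k z - a * e z ^ (n + 1))
      (by fun_prop) (by simp [hka, he1])
    have hh' : IsSymmElliptic L ρ (fun z => h z - a * u z ^ (n + 1)) := by
      refine ⟨?_, fun z hz ω hω => ?_, fun z hz => ?_⟩
      · exact hh.differentiableOn.sub ((hu.differentiableOn.pow _).const_mul _)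
      · rw [hh.periodic z hz ω hω, hu.periodic z hz ω hω]
      · rw [hh.symm z hz, hu.symm z hz]
    obtain ⟨P, hP, -, hPe⟩ := ih (a := g 0) hh' ⟨g, hg, rfl, by
      filter_upwards [hhk, hue, nhdsWithin_le_nhds hkg, self_mem_nhdsWithin] with z h1 h2 h3 h4
      apply mul_left_cancel₀ (show z ≠ 0 from h4)
      rw [← h3, ← h1, ← h2]
      ring⟩
    refine ⟨P + C a * X ^ (n + 1), ?_, ?_, fun z hz => ?_⟩
    · refine natDegree_add_le_of_degree_le (by omega) (natDegree_C_mul_X_pow_le _ _)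
    · rw [coeff_add, coeff_C_mul_X_pow, coeff_eq_zero_of_natDegree_lt (by omega)]
      simp
    · rw [eval_add, ← hPe z hz]
      simp

theorem not_bounded_of_hasPole {u : ℂ → ℂ} (hu1 : HasPoleLE u 1 1) (B : ℝ) :
    ¬ ∀ z ∈ regularSet L ρ, ‖u z‖ ≤ B := by
  intro hB
  obtain ⟨e, he, he1, hue⟩ := hu1
  have t1 : Tendsto (fun z => z * u z) (𝓝[≠] (0 : ℂ)) (𝓝 1) := by
    rw [← he1]
    refine (he.continuousAt.tendsto.mono_left nhdsWithin_le_nhds).congr' ?_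
    filter_upwards [hue] with z hz
    rw [← hz, pow_one]
  have t2 : Tendsto (fun z => z * u z) (𝓝[≠] (0 : ℂ)) (𝓝 0) := by
    have t3 : Tendsto (fun z : ℂ => ‖z‖ * B) (𝓝[≠] (0 : ℂ)) (𝓝 0) := by
      have : Tendsto (fun z : ℂ => ‖z‖ * B) (𝓝 (0 : ℂ)) (𝓝 (‖(0 : ℂ)‖ * B)) :=
        (continuous_norm.mul continuous_const).tendsto 0
      rw [norm_zero, zero_mul] at this
      exact this.mono_left nhdsWithin_le_nhds
    refine squeeze_zero_norm' ?_ t3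
    filter_upwards [eventually_mem_regularSet (L := L) (ρ := ρ) 0] with z hz
    rw [norm_mul]
    exact mul_le_mul_of_nonneg_left (hB z hz) (norm_nonneg _)
  exact one_ne_zero (tendsto_nhds_unique t1 t2)

theorem polynomial_eq_zero_of_forall_eval {u : ℂ → ℂ} (hu1 : HasPoleLE u 1 1) {p : ℂ[X]}
    (hp : ∀ z ∈ regularSet L ρ, p.eval (u z) = 0) : p = 0 := by
  by_contra hp0
  have hfin : (u '' regularSet L ρ).Finite := by
    refine (Polynomial.finite_setOfPred_isRoot hp0).subset ?_
    rintro _ ⟨z, hz, rfl⟩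
    exact hp z hz
  obtain ⟨B, hB⟩ := hfin.isBounded.exists_norm_le
  exact not_bounded_of_hasPole hu1 B fun z hz => hB _ ⟨z, hz, rfl⟩

theorem polynomial_ext_of_forall_eval {u : ℂ → ℂ} (hu1 : HasPoleLE u 1 1) {p r : ℂ[X]}
    (hp : ∀ z ∈ regularSet L ρ, p.eval (u z) = r.eval (u z)) : p = r :=
  sub_eq_zero.mp (polynomial_eq_zero_of_forall_eval (L := L) (ρ := ρ) hu1 fun z hz => by
    rw [eval_sub, hp z hz, sub_self])

/-- A symmetric elliptic function with a simple pole at the origin has a zero: otherwise its inverse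
would be constant. -/
theorem IsSymmElliptic.exists_zero {u : ℂ → ℂ} (hu : IsSymmElliptic L ρ u)
    (hu1 : HasPoleLE u 1 1) : ∃ z ∈ regularSet L ρ, u z = 0 := by
  by_contra! hne
  have hinv : IsSymmElliptic L ρ (fun z => (u z)⁻¹) := by
    refine ⟨hu.differentiableOn.inv hne, fun z hz ω hω => ?_, fun z hz => ?_⟩
    · rw [hu.periodic z hz ω hω]
    · rw [hu.symm z hz]
  have hu1' := hu1
  obtain ⟨e, he, he1, hue⟩ := hu1'
  have h0 : HasPoleLE (fun z => (u z)⁻¹) 0 0 := by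
    refine ⟨fun z => z * (e z)⁻¹, analyticAt_id.mul (he.inv (by simp [he1])), by simp, ?_⟩
    filter_upwards [hue, self_mem_nhdsWithin] with z hz hz0
    rw [← hz]
    have : z ≠ 0 := hz0
    simp only [pow_zero, one_mul, pow_one, mul_inv]
    rw [mul_inv_cancel_left₀ this]
  obtain ⟨z, hz⟩ := (eventually_mem_regularSet (L := L) (ρ := ρ) 0).exists
  exact inv_ne_zero (hne z hz) (hinv.eq_const h0 z hz)

end Elliptic

/-! ### The logarithmic derivative of an elliptic function of level `N` -/

section Level

open Filter Set Polynomial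

variable {L : PeriodPair} {ρ : ℂ} {N : ℕ} {F : ℂ → ℂ}

open Classical in
/-- The local description of an elliptic function `F` of level dividing `N` with pole at `ρ`,
extracted from its representation in normal form. -/
structure IsLevelFunction (L : PeriodPair) (ρ : ℂ) (N : ℕ) (F : ℂ → ℂ) : Prop where
  pos : 0 < N
  notMem : ρ ∉ L.lattice
  analyticAt_zero : AnalyticAt ℂ F 0
  map_zero : F 0 = 0
  deriv_zero : deriv F 0 = 1
  meromorphicAt : ∀ z, MeromorphicAt F z
  order : ∀ z, meromorphicOrderAt F z =
    (((if z ∈ L.lattice then 1 else 0) - (if z - ρ ∈ L.lattice then 1 else 0) : ℤ) : WithTop ℤ)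
  analyticAt : ∀ z ∈ regularSet L ρ, AnalyticAt ℂ F z
  ne_zero : ∀ z ∈ regularSet L ρ, F z ≠ 0
  eq_zero : ∀ z, z ∉ regularSet L ρ → F z = 0
  periodic : ∀ ω ∈ L.lattice, ∀ z, F (z + ω) ^ N = F z ^ N

theorem IsEllipticOfLevel.exists_isLevelFunction (h : IsEllipticOfLevel N L F) :
    ∃ ρ, IsLevelFunction L ρ N F := by
  classical
  obtain ⟨hNF, h0, h1, ⟨hpos, hper, ρ, hord⟩, -⟩ := h
  have hNF' (z : ℂ) : MeromorphicNFAt F z := hNF (mem_univ z)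
  have hN : (N : ℤ) ≠ 0 := by exact_mod_cast hpos.ne'
  have order (z : ℂ) : meromorphicOrderAt F z = (((if z ∈ L.lattice then 1 else 0) -
      (if z - ρ ∈ L.lattice then 1 else 0) : ℤ) : WithTop ℤ) := by
    have hz := hord z
    rw [fun_meromorphicOrderAt_pow (hNF' z).meromorphicAt] at hz
    induction hn : meromorphicOrderAt F z with
    | top =>
      rw [hn] at hz
      have : (N : WithTop ℤ) * ⊤ = ⊤ := WithTop.mul_top (by exact_mod_cast hpos.ne')
      rw [this] at hz
      exact absurd hz WithTop.top_ne_coe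
    | coe n =>
      rw [hn] at hz
      have hz' : (N : ℤ) * n = (if z ∈ L.lattice then (N : ℤ) else 0) -
          (if z - ρ ∈ L.lattice then (N : ℤ) else 0) := by exact_mod_cast hz
      congr 1
      apply mul_left_cancel₀ hN
      rw [hz']
      split_ifs <;> simp
  have hρ : ρ ∉ L.lattice := by
    intro hρ
    have := order 0
    rw [if_pos L.lattice.zero_mem, zero_sub, if_pos (L.lattice.neg_mem hρ), sub_self] at this
    exact (hNF' 0).meromorphicOrderAt_eq_zero_iff.mp this h0
  have hreg (z : ℂ) (hz : z ∈ regularSet L ρ) : meromorphicOrderAt F z = 0 := by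
    rw [order, if_neg hz.1, if_neg hz.2]; rfl
  refine ⟨ρ, hpos, hρ, ?_, h0, h1, fun z => (hNF' z).meromorphicAt, order, fun z hz => ?_,
    fun z hz => ?_, fun z hz => ?_, hper⟩
  · refine (hNF' 0).meromorphicOrderAt_nonneg_iff_analyticAt.mp ?_
    rw [order, if_pos L.lattice.zero_mem, zero_sub,
      if_neg (fun h => hρ (by simpa using L.lattice.neg_mem h))]
    exact WithTop.coe_le_coe.mpr (by norm_num)
  · exact (hNF' z).meromorphicOrderAt_nonneg_iff_analyticAt.mp (hreg z hz).ge
  · exact (hNF' z).meromorphicOrderAt_eq_zero_iff.mp (hreg z hz)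
  · by_contra hne
    have h2 := (hNF' z).meromorphicOrderAt_eq_zero_iff.mpr hne
    have h3 : (if z ∈ L.lattice then (1 : ℤ) else 0) - (if z - ρ ∈ L.lattice then 1 else 0) = 0 := by
      rw [order] at h2
      exact_mod_cast h2
    by_cases hz1 : z ∈ L.lattice
    · by_cases hz2 : z - ρ ∈ L.lattice
      · exact hρ (by simpa using L.lattice.sub_mem hz1 hz2)
      · simp [hz1, hz2] at h3
    · by_cases hz2 : z - ρ ∈ L.lattice
      · simp [hz1, hz2] at h3
      · exact hz ⟨hz1, hz2⟩

namespace IsLevelFunction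

variable (hF : IsLevelFunction L ρ N F)
include hF

theorem differentiableOn : DifferentiableOn ℂ F (regularSet L ρ) := fun z hz =>
  (hF.analyticAt z hz).differentiableAt.differentiableWithinAt

/-- If the `k`-th power of `F` is periodic then it has the divisor required of an elliptic function
of level dividing `k`. -/
theorem hasEllipticPower {k : ℕ}
    (hk : ∀ ω ∈ L.lattice, ∀ z ∈ regularSet L ρ, F (z + ω) ^ k = F z ^ k) :
    HasEllipticPower L k F := by
  classical
  refine ⟨fun ω hω z => ?_, ρ, fun z => ?_⟩
  · by_cases hz : z ∈ regularSet L ρ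
    · exact hk ω hω z hz
    · have hz' : z + ω ∉ regularSet L ρ := fun h => hz (by
        simpa using add_mem_regularSet h (L.lattice.neg_mem hω))
      simp only [hF.eq_zero z hz, hF.eq_zero _ hz']
  · rw [fun_meromorphicOrderAt_pow (hF.meromorphicAt z), hF.order z]
    rw [show (k : WithTop ℤ) = ((k : ℤ) : WithTop ℤ) from rfl, ← WithTop.coe_mul]
    congr 1
    split_ifs <;> simp

theorem hasDerivAt {z : ℂ} (hz : z ∈ regularSet L ρ) : HasDerivAt F (deriv F z) z :=
  (hF.analyticAt z hz).differentiableAt.hasDerivAt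

theorem differentiableOn_deriv : DifferentiableOn ℂ (deriv F) (regularSet L ρ) := fun z hz =>
  (hF.analyticAt z hz).deriv.differentiableAt.differentiableWithinAt

theorem exists_eq_mul : ∃ g, AnalyticAt ℂ g 0 ∧ g 0 = 1 ∧ ∀ᶠ z in 𝓝 (0 : ℂ), F z = z * g z := by
  obtain ⟨g, hg, hFg⟩ := exists_eq_mul_of_apply_zero hF.analyticAt_zero hF.map_zero
  refine ⟨g, hg, ?_, hFg⟩
  have h1 : HasDerivAt (fun z => z * g z) (1 * g 0 + 0 * deriv g 0) 0 :=
    (hasDerivAt_id (0 : ℂ)).mul hg.differentiableAt.hasDerivAt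
  have h2 := hF.deriv_zero
  rw [EventuallyEq.deriv_eq hFg, h1.deriv] at h2
  simpa using h2

theorem hasPoleLE_logDeriv : HasPoleLE (fun z => deriv F z / F z) 1 1 := by
  obtain ⟨g, hg, hg1, hFg⟩ := hF.exists_eq_mul
  refine ⟨fun z => deriv F z / g z, hF.analyticAt_zero.deriv.div hg (by simp [hg1]), by
    simp [hF.deriv_zero, hg1], ?_⟩
  filter_upwards [nhdsWithin_le_nhds hFg, self_mem_nhdsWithin] with z hz hz0
  have hz0 : z ≠ 0 := hz0
  rw [hz, pow_one, mul_div_assoc', mul_div_mul_left _ _ hz0]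

theorem periodic_logDeriv {z ω : ℂ} (hz : z ∈ regularSet L ρ) (hω : ω ∈ L.lattice) :
    deriv F (z + ω) / F (z + ω) = deriv F z / F z := by
  have hz' := add_mem_regularSet hz hω
  have h1 : HasDerivAt (fun w => F (w + ω) ^ N) (N * F (z + ω) ^ (N - 1) * deriv F (z + ω)) z := by
    have := (hF.hasDerivAt hz').comp_add_const z ω
    exact this.pow N
  have h2 : HasDerivAt (fun w => F w ^ N) (N * F z ^ (N - 1) * deriv F z) z :=
    (hF.hasDerivAt hz).pow N
  have h3 : (fun w => F (w + ω) ^ N) = fun w => F w ^ N := funext fun w => hF.periodic ω hω w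
  rw [h3] at h1
  have h4 := h1.unique h2
  have h5 := hF.periodic ω hω z
  have hN : (N : ℂ) ≠ 0 := by exact_mod_cast hF.pos.ne'
  have hs (w : ℂ) : F w ^ N = F w ^ (N - 1) * F w := by
    rw [← pow_succ, Nat.sub_add_cancel hF.pos]
  have n1 := hF.ne_zero _ hz'
  have n2 := hF.ne_zero _ hz
  have p2 : F z ^ (N - 1) ≠ 0 := pow_ne_zero _ n2
  rw [div_eq_div_iff n1 n2]
  apply mul_left_cancel₀ (mul_ne_zero hN p2)
  rw [hs, hs] at h5
  apply mul_left_cancel₀ n1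
  linear_combination (-(N : ℂ) * deriv F (z + ω) * F (z + ω)) * h5 + F (z + ω) * F (z + ω) * h4

theorem half_mem_regularSet : ρ / 2 ∈ regularSet L ρ := by
  have h1 : ρ / 2 ∉ L.lattice := fun h => hF.notMem (by
    simpa using L.lattice.add_mem h h)
  refine ⟨h1, fun h => h1 ?_⟩
  have := L.lattice.neg_mem h
  rwa [show -(ρ / 2 - ρ) = ρ / 2 by ring] at this

/-- The logarithmic derivative `u` has simple poles with residues `1` and `-1` at `0` and `ρ`, so
`u (ρ - z) - u z` has no poles; it is constant, and vanishes at `ρ / 2`. -/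
theorem symm_logDeriv {z : ℂ} (hz : z ∈ regularSet L ρ) :
    deriv F (ρ - z) / F (ρ - z) = deriv F z / F z := by
  set u : ℂ → ℂ := fun z => deriv F z / F z with hu
  have hud : DifferentiableOn ℂ u (regularSet L ρ) :=
    hF.differentiableOn_deriv.div hF.differentiableOn hF.ne_zero
  have hmaps : MapsTo (fun z => ρ - z) (regularSet L ρ) (regularSet L ρ) := fun z hz =>
    sub_mem_regularSet hz
  -- the behaviour of `u (ρ - z)` at the origin
  have hpole : ∃ k, AnalyticAt ℂ k 0 ∧ k 0 = 1 ∧ ∀ᶠ z in 𝓝[≠] (0 : ℂ), z * u (ρ - z) = k z := by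
    have hord : meromorphicOrderAt F ρ = ((-1 : ℤ) : WithTop ℤ) := by
      rw [hF.order, if_neg hF.notMem, sub_self, if_pos L.lattice.zero_mem]
      rfl
    obtain ⟨g, hg, hg0, hFg⟩ := (meromorphicOrderAt_eq_int_iff (hF.meromorphicAt ρ)).mp hord
    refine ⟨fun z => 1 + z * (deriv g (ρ - z) / g (ρ - z)), ?_, by simp, ?_⟩
    · have a1 : AnalyticAt ℂ (fun z => g (ρ - z)) 0 :=
        AnalyticAt.comp (g := g) (f := fun z => ρ - z) (by simpa using hg) (by fun_prop)
      have a2 : AnalyticAt ℂ (fun z => deriv g (ρ - z)) 0 :=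
        AnalyticAt.comp (g := deriv g) (f := fun z => ρ - z) (by simpa using hg.deriv)
          (by fun_prop)
      exact analyticAt_const.add (analyticAt_id.mul (a2.div a1 (by simpa using hg0)))
    · have ht : Tendsto (fun z => ρ - z) (𝓝[≠] 0) (𝓝[≠] ρ) := by
        refine tendsto_nhdsWithin_iff.mpr ⟨?_, ?_⟩
        · have : Tendsto (fun z => ρ - z) (𝓝 0) (𝓝 (ρ - 0)) :=
            (continuous_const.sub continuous_id).tendsto 0
          rw [sub_zero] at this
          exact this.mono_left nhdsWithin_le_nhds
        · filter_upwards [self_mem_nhdsWithin] with z hz hza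
          exact hz (by simpa using hza)
      have hFg' : ∀ᶠ y in 𝓝[≠] ρ, F =ᶠ[𝓝 y] fun z => (z - ρ)⁻¹ * g z := by
        have := eventually_eventually_nhdsWithin.mpr hFg
        filter_upwards [this, self_mem_nhdsWithin] with y hy hy0
        rw [isOpen_compl_singleton.nhdsWithin_eq hy0] at hy
        filter_upwards [hy] with z hz
        simpa using hz
      have hgan : ∀ᶠ y in 𝓝[≠] ρ, AnalyticAt ℂ g y :=
        nhdsWithin_le_nhds hg.eventually_analyticAt
      have hgne : ∀ᶠ y in 𝓝[≠] ρ, g y ≠ 0 :=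
        nhdsWithin_le_nhds (hg.continuousAt.eventually_ne hg0)
      filter_upwards [ht.eventually hFg', ht.eventually hgan, ht.eventually hgne,
        self_mem_nhdsWithin] with z h1 h2 h3 hz0
      have hz0 : z ≠ 0 := hz0
      have hy0 : ρ - z - ρ ≠ 0 := by simpa using hz0
      have hd : HasDerivAt (fun y => (y - ρ)⁻¹ * g y)
          (-1 / (ρ - z - ρ) ^ 2 * g (ρ - z) + (ρ - z - ρ)⁻¹ * deriv g (ρ - z)) (ρ - z) := by
        have := ((hasDerivAt_id (ρ - z)).sub_const ρ).inv hy0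
        exact this.mul h2.differentiableAt.hasDerivAt
      simp only [hu]
      rw [h1.deriv_eq, hd.deriv, h1.eq_of_nhds]
      have e : ρ - z - ρ = -z := by ring
      rw [e]
      field_simp
      ring
  obtain ⟨k, hk, hk1, huk⟩ := hpole
  obtain ⟨e, he, he1, hue⟩ := hF.hasPoleLE_logDeriv
  obtain ⟨d, hd, hkd⟩ := exists_eq_mul_of_apply_zero (k := fun z => k z - e z)
    (hk.sub he) (by simp [hk1, he1])
  have h0 : ∀ᶠ z in 𝓝[≠] (0 : ℂ), u (ρ - z) - u z = d z := by
    filter_upwards [huk, hue, nhdsWithin_le_nhds hkd, self_mem_nhdsWithin] with z h1 h2 h3 h4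
    apply mul_left_cancel₀ (show z ≠ 0 from h4)
    rw [← h3, ← h1, ← h2]
    ring
  have hdρ : AnalyticAt ℂ (fun z => -d (ρ - z)) ρ :=
    (AnalyticAt.comp (g := d) (f := fun z => ρ - z) (by simpa using hd) (by fun_prop)).neg
  have hρ : ∀ᶠ z in 𝓝[≠] ρ, u (ρ - z) - u z = -d (ρ - z) := by
    have ht : Tendsto (fun z => ρ - z) (𝓝[≠] ρ) (𝓝[≠] 0) := by
      refine tendsto_nhdsWithin_iff.mpr ⟨?_, ?_⟩
      · have : Tendsto (fun z => ρ - z) (𝓝 ρ) (𝓝 (ρ - ρ)) :=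
          (continuous_const.sub continuous_id).tendsto ρ
        rw [sub_self] at this
        exact this.mono_left nhdsWithin_le_nhds
      · filter_upwards [self_mem_nhdsWithin] with z hz hza
        exact hz (sub_eq_zero.mp hza).symm
    filter_upwards [ht.eventually h0] with z hz
    rw [← hz, sub_sub_cancel, neg_sub]
  have hper (z : ℂ) (hz : z ∈ regularSet L ρ) (ω : ℂ) (hω : ω ∈ L.lattice) :
      u (ρ - (z + ω)) - u (z + ω) = u (ρ - z) - u z := by
    simp only [hu]
    rw [hF.periodic_logDeriv hz hω, show ρ - (z + ω) = ρ - z + -ω by ring,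
      hF.periodic_logDeriv (sub_mem_regularSet hz) (L.lattice.neg_mem hω)]
  obtain ⟨c, hc⟩ := eq_const_of_periodic_of_removable (h := fun z => u (ρ - z) - u z)
    ((hud.comp (by fun_prop) hmaps).sub hud) hper ⟨d, hd, h0⟩ ⟨_, hdρ, hρ⟩
  have hc0 : c = 0 := by
    rw [← hc _ hF.half_mem_regularSet, show ρ - ρ / 2 = ρ / 2 by ring, sub_self]
  have := hc z hz
  rw [hc0] at this
  exact sub_eq_zero.mp this

theorem isSymmElliptic_logDeriv : IsSymmElliptic L ρ (fun z => deriv F z / F z) :=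
  ⟨hF.differentiableOn_deriv.div hF.differentiableOn hF.ne_zero,
    fun _ hz _ hω => hF.periodic_logDeriv hz hω, fun _ hz => hF.symm_logDeriv hz⟩

theorem exists_mul_symm_eq : ∃ c, c ≠ 0 ∧ ∀ z ∈ regularSet L ρ, F (ρ - z) = c * (F z)⁻¹ := by
  have hmaps : MapsTo (fun z => ρ - z) (regularSet L ρ) (regularSet L ρ) := fun z hz =>
    sub_mem_regularSet hz
  have hderiv : EqOn (deriv fun z => F z * F (ρ - z)) 0 (regularSet L ρ) := by
    intro z hz
    have h1 := (hF.hasDerivAt (sub_mem_regularSet hz)).comp_const_sub ρ z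
    have h2 := (hF.hasDerivAt hz).mul h1
    have h3 := hF.symm_logDeriv hz
    rw [div_eq_div_iff (hF.ne_zero _ (sub_mem_regularSet hz)) (hF.ne_zero _ hz)] at h3
    refine h2.deriv.trans ?_
    simp only [Pi.zero_apply]
    linear_combination -h3
  obtain ⟨c, hc⟩ := isOpen_regularSet.exists_is_const_of_deriv_eq_zero
    (isPreconnected_regularSet (L := L) (ρ := ρ)) (f := fun z => F z * F (ρ - z))
    (hF.differentiableOn.mul (hF.differentiableOn.comp (by fun_prop) hmaps)) hderiv
  have hne (z : ℂ) (hz : z ∈ regularSet L ρ) := hF.ne_zero z hz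
  refine ⟨c, ?_, fun z hz => ?_⟩
  · rw [← hc _ hF.half_mem_regularSet]
    exact mul_ne_zero (hne _ hF.half_mem_regularSet)
      (hne _ (sub_mem_regularSet hF.half_mem_regularSet))
  · rw [← hc z hz]
    have := hne z hz
    field_simp

/-- A function of level `N` is multiplied by a root of unity under translation by a period. -/
theorem exists_multiplier {ω : ℂ} (hω : ω ∈ L.lattice) :
    ∃ χ : ℂ, χ ^ N = 1 ∧ ∀ z ∈ regularSet L ρ, F (z + ω) = χ * F z := by
  have hmaps : MapsTo (fun z => z + ω) (regularSet L ρ) (regularSet L ρ) := fun z hz =>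
    add_mem_regularSet hz hω
  have hderiv : EqOn (deriv fun z => F (z + ω) / F z) 0 (regularSet L ρ) := by
    intro z hz
    have h1 := (hF.hasDerivAt (add_mem_regularSet hz hω)).comp_add_const z ω
    have h2 := h1.div (hF.hasDerivAt hz) (hF.ne_zero z hz)
    have h3 := hF.periodic_logDeriv hz hω
    rw [div_eq_div_iff (hF.ne_zero _ (add_mem_regularSet hz hω)) (hF.ne_zero _ hz)] at h3
    refine h2.deriv.trans ?_
    rw [h3]
    simp [mul_comm]
  obtain ⟨c, hc⟩ := isOpen_regularSet.exists_is_const_of_deriv_eq_zero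
    (isPreconnected_regularSet (L := L) (ρ := ρ)) (f := fun z => F (z + ω) / F z)
    ((hF.differentiableOn.comp (by fun_prop) hmaps).div hF.differentiableOn hF.ne_zero) hderiv
  have hz0 := hF.half_mem_regularSet
  refine ⟨c, ?_, fun z hz => ?_⟩
  · rw [← hc _ hz0, div_pow, hF.periodic ω hω, div_self (pow_ne_zero _ (hF.ne_zero _ hz0))]
  · rw [← hc z hz, div_mul_cancel₀ _ (hF.ne_zero z hz)]

end IsLevelFunction

end Level

/-! ### The quartic equation for the logarithmic derivative -/

section LogDeriv

open Filter Set Polynomial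

variable {L : PeriodPair} {ρ : ℂ} {N : ℕ} {F : ℂ → ℂ}

theorem HasPoleLE.deriv {u : ℂ → ℂ} (hu : HasPoleLE u 1 1) : HasPoleLE (_root_.deriv u) 2 (-1) := by
  obtain ⟨e, he, he1, hue⟩ := hu
  refine ⟨fun z => z * _root_.deriv e z - e z, (analyticAt_id.mul he.deriv).sub he, by simp [he1], ?_⟩
  have hue' : ∀ᶠ z in 𝓝[≠] (0 : ℂ), u =ᶠ[𝓝 z] fun z => z⁻¹ * e z := by
    filter_upwards [eventually_eventually_nhdsWithin.mpr hue, self_mem_nhdsWithin] with z hz hz0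
    rw [isOpen_compl_singleton.nhdsWithin_eq hz0] at hz
    filter_upwards [hz, isOpen_compl_singleton.mem_nhds hz0] with y hy hy0
    rw [← hy, pow_one, inv_mul_cancel_left₀ hy0]
  have hean : ∀ᶠ z in 𝓝[≠] (0 : ℂ), AnalyticAt ℂ e z := nhdsWithin_le_nhds he.eventually_analyticAt
  filter_upwards [hue', hean, self_mem_nhdsWithin] with z h1 h2 hz0
  have hz0 : z ≠ 0 := hz0
  have hd : HasDerivAt (fun z => z⁻¹ * e z) (-(z ^ 2)⁻¹ * e z + z⁻¹ * _root_.deriv e z) z :=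
    (hasDerivAt_inv hz0).mul h2.differentiableAt.hasDerivAt
  rw [h1.deriv_eq, hd.deriv]
  field_simp
  ring

theorem HasPoleLE.pow {h : ℂ → ℂ} {n : ℕ} {a : ℂ} (hh : HasPoleLE h n a) (m : ℕ) :
    HasPoleLE (fun z => h z ^ m) (n * m) (a ^ m) := by
  obtain ⟨k, hk, rfl, hhk⟩ := hh
  refine ⟨fun z => k z ^ m, hk.fun_pow m, rfl, ?_⟩
  filter_upwards [hhk] with z hz
  rw [← hz, mul_pow, ← pow_mul]

theorem IsSymmElliptic.sq_deriv {u : ℂ → ℂ} (hu : IsSymmElliptic L ρ u) :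
    IsSymmElliptic L ρ (fun z => deriv u z ^ 2) := by
  have hd {z : ℂ} (hz : z ∈ regularSet L ρ) : HasDerivAt u (deriv u z) z :=
    (hu.differentiableOn.differentiableAt (isOpen_regularSet.mem_nhds hz)).hasDerivAt
  refine ⟨(hu.differentiableOn.deriv isOpen_regularSet).pow 2, fun z hz ω hω => ?_, fun z hz => ?_⟩
  · have h1 := (hd (add_mem_regularSet hz hω)).comp_add_const z ω
    have h2 : (fun w => u (w + ω)) =ᶠ[𝓝 z] u := by
      filter_upwards [isOpen_regularSet.mem_nhds hz] with w hw
      exact hu.periodic w hw ω hω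
    rw [← h1.deriv, h2.deriv_eq]
  · have h1 := (hd (sub_mem_regularSet hz)).comp_const_sub ρ z
    have h2 : (fun w => u (ρ - w)) =ᶠ[𝓝 z] u := by
      filter_upwards [isOpen_regularSet.mem_nhds hz] with w hw
      exact hu.symm w hw
    have h3 := h1.deriv
    rw [h2.deriv_eq] at h3
    rw [h3, neg_sq]

/-- The symmetry of `u` makes `u'` antisymmetric, so that `u' ^ 2` is symmetric; its poles have order
four. -/
theorem IsSymmElliptic.exists_quartic {u : ℂ → ℂ} (hu : IsSymmElliptic L ρ u)
    (hu1 : HasPoleLE u 1 1) : ∃ R : ℂ[X], R.Monic ∧ R.natDegree = 4 ∧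
      ∀ z ∈ regularSet L ρ, deriv u z ^ 2 = R.eval (u z) := by
  obtain ⟨R, hR, hR4, hRe⟩ := hu.exists_polynomial hu1 4 hu.sq_deriv
    (by simpa using hu1.deriv.pow 2)
  have hd : R.natDegree = 4 :=
    le_antisymm hR (le_natDegree_of_ne_zero (by rw [hR4]; exact one_ne_zero))
  exact ⟨R, by rw [Monic, leadingCoeff, hd, hR4], hd, hRe⟩

theorem Polynomial.Monic.eq_quartic {p : ℂ[X]} (hp : p.Monic) (hd : p.natDegree = 4) :
    p = X ^ 4 + C (p.coeff 3) * X ^ 3 + C (p.coeff 2) * X ^ 2 + C (p.coeff 1) * X +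
      C (p.coeff 0) := by
  conv_lhs => rw [hp.as_sum, hd]
  simp [Finset.sum_range_succ]
  ring

namespace IsLevelFunction

variable (hF : IsLevelFunction L ρ N F)
include hF

theorem logDerivQuartic {R : ℂ[X]} (hR : R.Monic) (hR4 : R.natDegree = 4)
    (hRe : ∀ z ∈ regularSet L ρ, deriv (fun z => deriv F z / F z) z ^ 2 =
      R.eval (deriv F z / F z)) :
    LogDerivQuartic (R.coeff 3) (R.coeff 2) (R.coeff 1) (R.coeff 0) (taylorSeries F) := by
  have a0 := hF.analyticAt_zero
  have a1 := a0.deriv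
  have a2 := a1.deriv
  have key : ∀ᶠ z in 𝓝[≠] (0 : ℂ), (F z * deriv (deriv F) z + (-1) * deriv F z ^ 2) ^ 2 =
      deriv F z ^ 4 + R.coeff 3 * (deriv F z ^ 3 * F z) + R.coeff 2 * (deriv F z ^ 2 * F z ^ 2) +
        R.coeff 1 * (deriv F z * F z ^ 3) + R.coeff 0 * F z ^ 4 := by
    filter_upwards [eventually_mem_regularSet 0] with z hz
    have h0 := hF.ne_zero z hz
    have h1 := (hF.analyticAt z hz).deriv.differentiableAt.hasDerivAt.div (hF.hasDerivAt hz) h0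
    have h2 := hRe z hz
    rw [show deriv (fun z => deriv F z / F z) z = _ from h1.deriv, hR.eq_quartic hR4] at h2
    simp only [eval_add, eval_mul, eval_pow, eval_X, eval_C] at h2
    field_simp at h2
    linear_combination h2
  have e1 : AnalyticAt ℂ (fun z => F z * deriv (deriv F) z + (-1) * deriv F z ^ 2) 0 := by fun_prop
  have heq := (AnalyticAt.frequently_eq_iff_eventually_eq (e1.fun_pow 2) (by fun_prop)).mp
    key.frequently
  have ht := taylorSeries_congr heq
  refine ⟨by rw [coeff_zero_taylorSeries, hF.map_zero],
    by rw [coeff_one_taylorSeries, hF.deriv_zero], ?_⟩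
  have c (r : ℂ) : AnalyticAt ℂ (fun _ : ℂ => r) 0 := analyticAt_const
  rw [taylorSeries_pow e1, taylorSeries_add (a0.fun_mul a2) ((c _).fun_mul (a1.fun_pow 2)),
    taylorSeries_mul a0 a2, taylorSeries_mul (c _) (a1.fun_pow 2), taylorSeries_pow a1,
    taylorSeries_const,
    taylorSeries_add (by fun_prop) (by fun_prop), taylorSeries_add (by fun_prop) (by fun_prop),
    taylorSeries_add (by fun_prop) (by fun_prop), taylorSeries_add (by fun_prop) (by fun_prop),
    taylorSeries_mul (c _) (by fun_prop), taylorSeries_mul (c _) (by fun_prop),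
    taylorSeries_mul (c _) (by fun_prop), taylorSeries_mul (c _) (by fun_prop),
    taylorSeries_mul (by fun_prop) (by fun_prop), taylorSeries_mul (by fun_prop) (by fun_prop),
    taylorSeries_mul (by fun_prop) (by fun_prop),
    taylorSeries_pow a1, taylorSeries_pow a1, taylorSeries_pow a1, taylorSeries_pow a0,
    taylorSeries_pow a0, taylorSeries_pow a0] at ht
  simp only [taylorSeries_const, taylorSeries_deriv, map_neg, map_one] at ht
  rw [← ht]
  ring

end IsLevelFunction

end LogDeriv

/-! ### Pell equations for functions of even level -/

section EvenLevel

open Filter Set Polynomial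

variable {L : PeriodPair} {ρ : ℂ} {N : ℕ} {F : ℂ → ℂ}

namespace IsLevelFunction

theorem hasDerivAt_inv_pow_add (hF : IsLevelFunction L ρ N F) (k : ℕ) (m : ℂ) {z : ℂ}
    (hz : z ∈ regularSet L ρ) :
    HasDerivAt (fun z => (F z)⁻¹ ^ k + m * F z ^ k)
      (-(k * (deriv F z / F z) * ((F z)⁻¹ ^ k - m * F z ^ k))) z := by
  have h0 := hF.ne_zero z hz
  have h1 := hF.hasDerivAt hz
  convert! ((h1.inv h0).pow k).add ((h1.pow k).const_mul m) using 1
  cases k with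
  | zero => simp
  | succ k =>
    rw [Nat.add_sub_cancel]
    simp only [Pi.inv_apply, inv_pow, pow_succ]
    field_simp
    ring

/-- Elliptic functions of even level `2 k` and Pell equations: with `F z * F (ρ - z) = c` and
`m = c⁻¹ ^ k`, the square of `F⁻¹ ^ k ± m F ^ k` is a polynomial in `u = F' / F`, and comparing the
derivatives of both sides gives the equation. -/
theorem exists_pell {k : ℕ} (hk : 0 < k) (hF : IsLevelFunction L ρ (2 * k) F) {R : ℂ[X]}
    (hRe : ∀ z ∈ regularSet L ρ, deriv (fun z => deriv F z / F z) z ^ 2 =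
      R.eval (deriv F z / F z)) :
    ∃ (m : ℂ) (P T : ℂ[X]), m ≠ 0 ∧ P.Monic ∧ P.natDegree = 2 * k ∧ T.Monic ∧
      derivative P = C (2 * k : ℂ) * X * T ∧ R * T ^ 2 = P * (P - C (4 * m)) ∧
      (∀ z ∈ regularSet L ρ, ((F z)⁻¹ ^ k + m * F z ^ k) ^ 2 = P.eval (deriv F z / F z)) ∧
      (∀ z ∈ regularSet L ρ,
        ((F z)⁻¹ ^ k + (-m) * F z ^ k) ^ 2 = (P - C (4 * m)).eval (deriv F z / F z)) := by
  have hu := hF.isSymmElliptic_logDeriv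
  have hu1 := hF.hasPoleLE_logDeriv
  obtain ⟨c, hc0, hc⟩ := hF.exists_mul_symm_eq
  set m : ℂ := c⁻¹ ^ k with hm
  have hmc : m * c ^ k = 1 := by rw [hm, ← mul_pow, inv_mul_cancel₀ hc0, one_pow]
  have hm0 : m ≠ 0 := pow_ne_zero _ (inv_ne_zero hc0)
  have hk0 : (k : ℂ) ≠ 0 := by exact_mod_cast hk.ne'
  set V₁ : ℂ → ℂ := fun z => (F z)⁻¹ ^ k + m * F z ^ k with hV₁
  have hinv {z : ℂ} (hz : z ∈ regularSet L ρ) : (F z)⁻¹ ^ k * F z ^ k = 1 := by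
    rw [← mul_pow, inv_mul_cancel₀ (hF.ne_zero z hz), one_pow]
  have hsymm : IsSymmElliptic L ρ (fun z => V₁ z ^ 2) := by
    refine ⟨fun z hz => ?_, fun z hz ω hω => ?_, fun z hz => ?_⟩
    · exact ((hF.hasDerivAt_inv_pow_add k m hz).differentiableAt.fun_pow 2).differentiableWithinAt
    · have h1 := hF.periodic ω hω z
      have e (w : ℂ) (hw : w ∈ regularSet L ρ) :
          V₁ w ^ 2 = (F w ^ (2 * k))⁻¹ + m ^ 2 * F w ^ (2 * k) + 2 * m := by
        have h2 := hF.ne_zero w hw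
        simp only [hV₁, inv_pow]
        field_simp
        ring
      rw [e _ (add_mem_regularSet hz hω), e z hz, h1]
    · have h2 := hF.ne_zero z hz
      simp only [hV₁, hc z hz]
      congr 1
      rw [mul_inv, inv_inv, mul_pow, mul_pow, ← mul_assoc, hmc, one_mul, ← hm]
      ring
  have hpole : HasPoleLE (fun z => V₁ z ^ 2) (2 * k) 1 := by
    obtain ⟨g, hg, hg1, hFg⟩ := hF.exists_eq_mul
    refine ⟨fun z => ((g z)⁻¹ ^ k + m * z ^ k * F z ^ k) ^ 2, ?_, by simp [hg1, hk.ne'], ?_⟩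
    · have a1 := hF.analyticAt_zero
      have a2 := hg.fun_inv (by simp [hg1])
      fun_prop
    · filter_upwards [nhdsWithin_le_nhds hFg, self_mem_nhdsWithin] with z hz hz0
      have hz0 : z ≠ 0 := hz0
      simp only [hV₁]
      rw [show (F z)⁻¹ = z⁻¹ * (g z)⁻¹ by rw [hz, mul_inv], mul_pow z⁻¹]
      have : z ^ k * z⁻¹ ^ k = 1 := by rw [← mul_pow, mul_inv_cancel₀ hz0, one_pow]
      rw [pow_mul', ← mul_pow]
      congr 1
      linear_combination (g z)⁻¹ ^ k * this
  obtain ⟨P, hPd, hPc, hPe⟩ := hu.exists_polynomial hu1 (2 * k) hsymm hpole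
  have hPd' : P.natDegree = 2 * k :=
    le_antisymm hPd (le_natDegree_of_ne_zero (by rw [hPc]; exact one_ne_zero))
  have hPm : P.Monic := by rw [Monic, leadingCoeff, hPd', hPc]
  have hP₂ {z : ℂ} (hz : z ∈ regularSet L ρ) :
      ((F z)⁻¹ ^ k - m * F z ^ k) ^ 2 = (P - C (4 * m)).eval (deriv F z / F z) := by
    rw [eval_sub, eval_C, ← hPe z hz]
    linear_combination -4 * m * hinv hz
  have hud {z : ℂ} (hz : z ∈ regularSet L ρ) :
      HasDerivAt (fun z => deriv F z / F z) (deriv (fun z => deriv F z / F z) z) z :=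
    (hu.differentiableOn.differentiableAt (isOpen_regularSet.mem_nhds hz)).hasDerivAt
  -- differentiate `V₁ ^ 2 = P (u)`
  have hder {z : ℂ} (hz : z ∈ regularSet L ρ) :
      (derivative P).eval (deriv F z / F z) * deriv (fun z => deriv F z / F z) z =
        deriv F z / F z * (-(2 * k) * V₁ z * ((F z)⁻¹ ^ k - m * F z ^ k)) := by
    have h1 : HasDerivAt (fun z => P.eval (deriv F z / F z))
        ((derivative P).eval (deriv F z / F z) * deriv (fun z => deriv F z / F z) z) z :=
      HasDerivAt.comp (h₂ := fun x => P.eval x) z (P.hasDerivAt (deriv F z / F z)) (hud hz)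
    have h2 := (hF.hasDerivAt_inv_pow_add k m hz).fun_pow 2
    have h3 : (fun z => V₁ z ^ 2) =ᶠ[𝓝 z] fun z => P.eval (deriv F z / F z) := by
      filter_upwards [isOpen_regularSet.mem_nhds hz] with w hw using hPe w hw
    rw [← h1.deriv, ← h3.deriv_eq, h2.deriv]
    simp only [hV₁]
    push_cast
    ring
  -- at a zero of `u` the orders of vanishing of the two sides are incompatible, unless `P' (0) = 0`
  have hP0 : (derivative P).eval 0 = 0 := by
    by_contra hne
    obtain ⟨z₀, hz₀, huz₀⟩ := hu.exists_zero hu1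
    have huan : AnalyticOnNhd ℂ (fun z => deriv F z / F z) (regularSet L ρ) :=
      hu.differentiableOn.analyticOnNhd isOpen_regularSet
    set u : ℂ → ℂ := fun z => deriv F z / F z with hu_def
    have hord := (huan z₀ hz₀).analyticOrderAt_deriv_add_one
    have hu0 : (fun z => u z - u z₀) = u := by
      funext z
      rw [show u z₀ = 0 from huz₀, sub_zero]
    rw [hu0] at hord
    have hA : AnalyticAt ℂ (fun z => (derivative P).eval (u z)) z₀ :=
      AnalyticAt.comp (g := fun x => (derivative P).eval x) (f := u)
        ((derivative P).differentiable.analyticAt _) (huan z₀ hz₀)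
    have hA0 : analyticOrderAt (fun z => (derivative P).eval (u z)) z₀ = 0 := by
      rw [hA.analyticOrderAt_eq_zero, show u z₀ = 0 from huz₀]
      exact hne
    have hFan := hF.analyticAt z₀ hz₀
    have hB : AnalyticAt ℂ (fun z => -(2 * k) * V₁ z * ((F z)⁻¹ ^ k - m * F z ^ k)) z₀ := by
      have := hFan.fun_inv (hF.ne_zero z₀ hz₀)
      simp only [hV₁]
      fun_prop
    have heq : (fun z => (derivative P).eval (u z)) * deriv u =ᶠ[𝓝 z₀]
        u * fun z => -(2 * k) * V₁ z * ((F z)⁻¹ ^ k - m * F z ^ k) := by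
      filter_upwards [isOpen_regularSet.mem_nhds hz₀] with z hz using hder hz
    have h1 := analyticOrderAt_congr heq
    rw [analyticOrderAt_mul hA (huan z₀ hz₀).deriv, analyticOrderAt_mul (huan z₀ hz₀) hB, hA0,
      zero_add, ← hord] at h1
    have htop : analyticOrderAt (deriv u) z₀ = ⊤ := by
      by_contra hnt
      obtain ⟨n, hn⟩ := ENat.ne_top_iff_exists.mp hnt
      rw [← hn] at h1
      have h2 : ((n + 1 : ℕ) : ℕ∞) ≤ (n : ℕ∞) := by
        rw [h1]
        push_cast
        exact le_self_add
      have h3 : n + 1 ≤ n := by exact_mod_cast h2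
      omega
    rw [htop, top_add] at hord
    have hz := huan.eqOn_zero_of_preconnected_of_eventuallyEq_zero isPreconnected_regularSet hz₀
      (analyticOrderAt_eq_top.mp hord.symm)
    exact not_bounded_of_hasPole (L := L) (ρ := ρ) hu1 0 fun z hzΩ => by
      rw [show u z = 0 from hz hzΩ, norm_zero]
  obtain ⟨T', hT'⟩ : X ∣ derivative P := by
    rw [X_dvd_iff, coeff_zero_eq_eval_zero, hP0]
  have h2k : (2 * k : ℂ) ≠ 0 := mul_ne_zero two_ne_zero hk0
  have hdT : derivative P = C (2 * k : ℂ) * X * (C (2 * k : ℂ)⁻¹ * T') := by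
    rw [hT']
    have : C (2 * k : ℂ) * C (2 * k : ℂ)⁻¹ = (1 : ℂ[X]) := by
      rw [← C_mul, mul_inv_cancel₀ h2k, C_1]
    linear_combination -X * T' * this
  set T := C (2 * k : ℂ)⁻¹ * T' with hT
  refine ⟨m, P, T, hm0, hPm, hPd', ?_, hdT, ?_, hPe, fun z hz => ?_⟩
  · have h1 := congrArg leadingCoeff hdT
    rw [leadingCoeff_mul, leadingCoeff_mul, leadingCoeff_C, leadingCoeff_X, mul_one,
      leadingCoeff_derivative, hPd', hPm.leadingCoeff] at h1
    apply mul_left_cancel₀ h2k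
    rw [← h1]
    push_cast
    ring
  · have h0 : C (2 * k : ℂ) * X ≠ 0 := mul_ne_zero (C_ne_zero.mpr h2k) X_ne_zero
    apply mul_left_cancel₀ (pow_ne_zero 2 h0)
    have : (C (2 * k : ℂ) * X) ^ 2 * (R * T ^ 2) = derivative P ^ 2 * R := by rw [hdT]; ring
    rw [this]
    refine polynomial_ext_of_forall_eval (L := L) (ρ := ρ) hu1 fun z hz => ?_
    have h1 := hder hz
    have h2 := hP₂ hz
    have h3 := hPe z hz
    have h4 := hRe z hz
    simp only [eval_mul, eval_pow, eval_C, eval_X]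
    rw [← h2, ← h3, ← h4]
    linear_combination ((derivative P).eval (deriv F z / F z) *
      deriv (fun z => deriv F z / F z) z + deriv F z / F z * (-(2 * k) * V₁ z *
        ((F z)⁻¹ ^ k - m * F z ^ k))) * h1
  · rw [← hP₂ hz]
    ring

/-- If `F⁻¹ ^ k + m F ^ k`, which is periodic up to sign, is a polynomial in the periodic function
`F' / F`, then the sign is always positive and `F ^ k` is itself periodic. -/
theorem pow_periodic_of_sq_eq {k : ℕ} (hF : IsLevelFunction L ρ (2 * k) F) {m : ℂ} {S : ℂ[X]}
    (hS : S ≠ 0) (h : ∀ z ∈ regularSet L ρ,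
      ((F z)⁻¹ ^ k + m * F z ^ k) ^ 2 = S.eval (deriv F z / F z) ^ 2) :
    ∀ ω ∈ L.lattice, ∀ z ∈ regularSet L ρ, F (z + ω) ^ k = F z ^ k := by
  have hu := hF.isSymmElliptic_logDeriv
  have hu1 := hF.hasPoleLE_logDeriv
  set V : ℂ → ℂ := fun z => (F z)⁻¹ ^ k + m * F z ^ k with hV
  have hVd : DifferentiableOn ℂ V (regularSet L ρ) := fun z hz =>
    (hF.hasDerivAt_inv_pow_add k m hz).differentiableAt.differentiableWithinAt
  have hSd : DifferentiableOn ℂ (fun z => S.eval (deriv F z / F z)) (regularSet L ρ) :=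
    S.differentiable.comp_differentiableOn hu.differentiableOn
  have hor := AnalyticOnNhd.eq_zero_or_eq_zero_of_mul_eq_zero
    ((hVd.sub hSd).analyticOnNhd isOpen_regularSet) ((hVd.add hSd).analyticOnNhd isOpen_regularSet)
    (fun z hz => by
      have := h z hz
      simp only [Pi.sub_apply, Pi.add_apply]
      linear_combination this) isPreconnected_regularSet
  have hVper (z : ℂ) (hz : z ∈ regularSet L ρ) (ω : ℂ) (hω : ω ∈ L.lattice) :
      V (z + ω) = V z := by
    have hz' := add_mem_regularSet hz hω
    have hp := hF.periodic_logDeriv hz hω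
    rcases hor with h1 | h1
    · have e1 : V (z + ω) - S.eval (deriv F (z + ω) / F (z + ω)) = 0 := h1 _ hz'
      have e2 : V z - S.eval (deriv F z / F z) = 0 := h1 z hz
      rw [hp] at e1
      linear_combination e1 - e2
    · have e1 : V (z + ω) + S.eval (deriv F (z + ω) / F (z + ω)) = 0 := h1 _ hz'
      have e2 : V z + S.eval (deriv F z / F z) = 0 := h1 z hz
      rw [hp] at e1
      linear_combination e1 - e2
  intro ω hω z hz
  obtain ⟨χ, hχ, hχF⟩ := hF.exists_multiplier hω
  have hε : χ ^ k * χ ^ k = 1 := by rw [← pow_add, ← two_mul, hχ]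
  have hε' : χ⁻¹ ^ k = χ ^ k := by rw [inv_pow]; exact inv_eq_of_mul_eq_one_left hε
  obtain ⟨z₁, hz₁, hVz₁⟩ : ∃ z ∈ regularSet L ρ, V z ≠ 0 := by
    by_contra! hcon
    refine hS (polynomial_eq_zero_of_forall_eval (L := L) (ρ := ρ) hu1 fun z hz => ?_)
    have := h z hz
    rw [show (F z)⁻¹ ^ k + m * F z ^ k = 0 from hcon z hz] at this
    exact pow_eq_zero_iff two_ne_zero |>.mp (by rw [← this]; ring)
  have h1 : V (z₁ + ω) = χ ^ k * V z₁ := by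
    simp only [hV, hχF z₁ hz₁, mul_inv, mul_pow, hε']
    ring
  rw [hVper z₁ hz₁ ω hω] at h1
  have hone : χ ^ k = 1 := mul_right_cancel₀ hVz₁ (by rw [← h1, one_mul])
  rw [hχF z hz, mul_pow, hone, one_mul]

/-- If `F` is odd then its multipliers are `1` and `-1`. -/
theorem sq_periodic_of_odd (hF : IsLevelFunction L ρ N F) (hodd : ∀ᶠ z in 𝓝 0, F (-z) = -F z) :
    ∀ ω ∈ L.lattice, ∀ z ∈ regularSet L ρ, F (z + ω) ^ 2 = F z ^ 2 := by
  set Ω : Set ℂ := {z | z ∈ regularSet L ρ ∧ -z ∈ regularSet L ρ} with hΩ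
  have hconn : IsPreconnected Ω := by
    have hc : Ωᶜ.Countable := by
      refine ((countable_compl_regularSet (L := L) (ρ := ρ)).union
        ((countable_compl_regularSet (L := L) (ρ := ρ)).image fun z => -z)).mono fun z hz => ?_
      by_contra hcon
      rw [mem_union, not_or] at hcon
      exact hz ⟨not_not.mp hcon.1, not_not.mp fun h => hcon.2 ⟨-z, h, neg_neg z⟩⟩
    have := Set.Countable.isConnected_compl_of_one_lt_rank (E := ℂ) (by simp) hc
    rw [compl_compl] at this
    exact this.isPreconnected
  have hneg : ∀ᶠ z in 𝓝[≠] (0 : ℂ), z ∈ Ω := by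
    have ht : Tendsto (fun z : ℂ => -z) (𝓝[≠] 0) (𝓝[≠] 0) := by
      refine tendsto_nhdsWithin_iff.mpr ⟨?_, ?_⟩
      · have : Tendsto (fun z : ℂ => -z) (𝓝 0) (𝓝 (-0)) := continuous_neg.tendsto 0
        rw [neg_zero] at this
        exact this.mono_left nhdsWithin_le_nhds
      · filter_upwards [self_mem_nhdsWithin] with z hz hza
        exact hz (by simpa using hza)
    exact (eventually_mem_regularSet 0).and (ht.eventually (eventually_mem_regularSet 0))
  obtain ⟨z₀, hz₀, hodd₀⟩ :=
    (hneg.and (nhdsWithin_le_nhds (eventually_eventually_nhds.mpr hodd))).exists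
  have h1 : AnalyticOnNhd ℂ (fun z => F (-z)) Ω := fun z hz =>
    AnalyticAt.comp (g := F) (f := fun z => -z) (hF.analyticAt _ hz.2) (by fun_prop)
  have h2 : AnalyticOnNhd ℂ (fun z => -F z) Ω := fun z hz => (hF.analyticAt _ hz.1).neg
  have hglob : EqOn (fun z => F (-z)) (fun z => -F z) Ω :=
    h1.eqOn_of_preconnected_of_eventuallyEq h2 hconn hz₀ hodd₀
  intro ω hω z hz
  have hω' := L.lattice.neg_mem hω
  obtain ⟨χ, -, hχ⟩ := hF.exists_multiplier hω
  obtain ⟨χ', -, hχ'⟩ := hF.exists_multiplier hω'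
  have hz₀' : z₀ + ω ∈ Ω := ⟨add_mem_regularSet hz₀.1 hω, by
    rw [neg_add]; exact add_mem_regularSet hz₀.2 hω'⟩
  have hne := hF.ne_zero z₀ hz₀.1
  have e1 : F (-(z₀ + ω)) = -F (z₀ + ω) := hglob hz₀'
  have e2 : F (-z₀) = -F z₀ := hglob hz₀
  rw [neg_add, hχ' _ hz₀.2, hχ _ hz₀.1, e2] at e1
  have e3 := hχ' _ (add_mem_regularSet hz₀.1 hω)
  rw [add_neg_cancel_right, hχ _ hz₀.1] at e3
  have e4 : χ' = χ := mul_right_cancel₀ hne (by linear_combination -e1)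
  have e5 : χ ^ 2 = 1 := mul_right_cancel₀ hne (by rw [e4] at e3; linear_combination -e3)
  rw [hχ z hz, mul_pow, e5, one_mul]

end IsLevelFunction

end EvenLevel

/-! ### The parameters of elliptic functions of levels two and six -/

section LevelSet

open Filter Set Polynomial

variable {L : PeriodPair} {ρ : ℂ} {N : ℕ} {F : ℂ → ℂ}

/-- The expansion of an elliptic function of level `N` solves the differential equation, so it gives
a point of `levelSet N`. -/
theorem IsEllipticOfLevel.exists_isSeriesSolution (h : IsEllipticOfLevel N L F) :
    ∃ q ∈ levelSet N, IsSeriesSolution q (taylorSeries F) := by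
  obtain ⟨ρ, hF⟩ := h.exists_isLevelFunction
  obtain ⟨R, hR, hR4, hRe⟩ := hF.isSymmElliptic_logDeriv.exists_quartic hF.hasPoleLE_logDeriv
  have hq := hF.logDerivQuartic hR hR4 hRe
  obtain ⟨Q, hQ, hQ0⟩ := exists_mul_eq_X hq.1 hq.2.1
  have hs := hq.isSeriesSolution hQ hQ0
  exact ⟨_, ⟨_, hs, L, F, h, isSeriesExpansion_taylorSeries hF.analyticAt_zero⟩, hs⟩

theorem IsLevelFunction.exists_quartic (hF : IsLevelFunction L ρ N F) {q : Fin 4 → ℂ}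
    (hq : IsSeriesSolution q (taylorSeries F)) :
    ∃ R : ℂ[X], R.Monic ∧ R.natDegree = 4 ∧
      (∀ z ∈ regularSet L ρ, deriv (fun z => deriv F z / F z) z ^ 2 =
        R.eval (deriv F z / F z)) ∧
      R.coeff 3 = 4 * q 0 ∧ R.coeff 2 = 12 * q 1 ∧ R.coeff 1 = 24 * q 2 ∧
      R.coeff 0 = 40 * q 3 - 16 * q 0 * q 2 + 8 * q 1 ^ 2 := by
  obtain ⟨R, hR, hR4, hRe⟩ := hF.isSymmElliptic_logDeriv.exists_quartic hF.hasPoleLE_logDeriv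
  obtain ⟨-, -, ⟨Q, hQ, hQ0, hQq⟩, -⟩ := hq
  have hc := (hF.logDerivQuartic hR hR4 hRe).coeff_eq hQ hQ0
  have h0 : PowerSeries.coeff 1 Q = q 0 := hQq 0
  have h1 : PowerSeries.coeff 2 Q = q 1 := hQq 1
  have h2 : PowerSeries.coeff 3 Q = q 2 := hQq 2
  have h3 : PowerSeries.coeff 4 Q = q 3 := hQq 3
  rw [h0, h1, h2, h3] at hc
  exact ⟨R, hR, hR4, hRe, hc⟩

theorem levelSet_two_subset : levelSet 2 ⊆ evenPlane := by
  rintro q ⟨f, hq, L, F, hF, hf⟩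
  rw [hf.eq_taylorSeries] at hq
  obtain ⟨ρ, hF⟩ := hF.exists_isLevelFunction
  obtain ⟨R, hR, hR4, hRe, h3, -, h1, -⟩ := hF.exists_quartic hq
  obtain ⟨m, P, T, -, hP, hP2, hT, hd, hpell, -, -⟩ := hF.exists_pell (k := 1) one_pos hRe
  -- `P = X ^ 2 + b` and `T = 1`, so that `R = P (P - 4 m)` is even
  have hPq := hP.eq_quadratic hP2
  have hP1 : P.coeff 1 = 0 := by
    have := congrArg (coeff · 0) hd
    simpa [coeff_derivative, mul_assoc] using this
  have hT1 : T = 1 := by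
    rw [hPq, hP1] at hd
    have h2 : C (2 * (1 : ℕ) : ℂ) * X ≠ (0 : ℂ[X]) :=
      mul_ne_zero (C_ne_zero.mpr (by norm_num)) X_ne_zero
    apply mul_left_cancel₀ h2
    rw [← hd]
    simp only [derivative_add, derivative_X_pow, derivative_C, C_0, zero_mul, derivative_zero]
    norm_num
  have hRq : R = X ^ 4 + C (2 * P.coeff 0 - 4 * m) * X ^ 2 +
      C (P.coeff 0 * (P.coeff 0 - 4 * m)) := by
    rw [hT1, one_pow, mul_one] at hpell
    rw [hP1, C_0, zero_mul, add_zero] at hPq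
    generalize P.coeff 0 = b at hPq ⊢
    rw [hpell, hPq]
    simp only [C_sub, C_mul, show (C 2 : ℂ[X]) = 2 from rfl]
    ring
  rw [hRq] at h3 h1
  simp only [coeff_add, coeff_C_mul, coeff_X_pow, coeff_C] at h3 h1
  norm_num at h3 h1
  exact ⟨h3, h1⟩

theorem weightedScale_neg_one {q : Fin 4 → ℂ} (hq : q ∈ evenPlane) : weightedScale (-1) q = q := by
  obtain ⟨h0, h2⟩ := hq
  funext i
  fin_cases i <;> simp [weightedScale, h0, h2]
  all_goals norm_num

/-- When `q₁ = q₃ = 0`, uniqueness of the solution with given parameters makes it odd. -/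
theorem IsLevelFunction.odd_of_mem_evenPlane (hF : IsLevelFunction L ρ N F) {q : Fin 4 → ℂ}
    (hq : IsSeriesSolution q (taylorSeries F)) (he : q ∈ evenPlane) :
    ∀ᶠ z in 𝓝 0, F (-z) = -F z := by
  have h1 := hq.rescale (μ := -1) (by norm_num)
  rw [weightedScale_neg_one he, ← taylorSeries_scale] at h1
  have ha : AnalyticAt ℂ (fun z => (-1 : ℂ)⁻¹ * F (-1 * z)) 0 := by
    have := hF.analyticAt_zero
    have : AnalyticAt ℂ (fun z => F (-1 * z)) 0 :=
      AnalyticAt.comp (g := F) (f := fun z => -1 * z) (by simpa using this) (by fun_prop)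
    exact analyticAt_const.fun_mul this
  filter_upwards [eventuallyEq_of_taylorSeries_eq hF.analyticAt_zero ha (hq.unique h1)] with z hz
  rw [hz]
  norm_num

/-- At level six the Pell equation confines the parameters to the two components. On the plane
`q₁ = q₃ = 0` the function would be odd, hence of level at most two. -/
theorem levelSet_six_subset : levelSet 6 ⊆ {q | q 0 ≠ 0 ∧ q ∈ surface} := by
  rintro q ⟨f, hq, L, F, hFl, hf⟩
  rw [hf.eq_taylorSeries] at hq
  have hleast := hFl.2.2.2.2
  obtain ⟨ρ, hF⟩ := hFl.exists_isLevelFunction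
  obtain ⟨R, hR, hR4, hRe, h3, h2, h1, h0⟩ := hF.exists_quartic hq
  obtain ⟨m, P, T, hm, hP, hP6, hT, hd, hpell, hP₁, hP₂⟩ :=
    hF.exists_pell (k := 3) (by norm_num) hRe
  have hnot {m : ℂ} {P : ℂ[X]} (hP0 : P ≠ 0)
      (h : ∀ z ∈ regularSet L ρ, ((F z)⁻¹ ^ 3 + m * F z ^ 3) ^ 2 = P.eval (deriv F z / F z)) :
      ¬∃ S, P = S ^ 2 := by
    rintro ⟨S, rfl⟩
    have hp := hF.pow_periodic_of_sq_eq (k := 3) (m := m) (S := S)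
      (fun h => hP0 (by rw [h]; ring)) fun z hz => by rw [h z hz, eval_pow]
    have := hleast ⟨by norm_num, hF.hasEllipticPower hp⟩
    norm_num at this
  obtain ⟨a₁, b₁, a₂, b₂, hRf, e₁, e₂⟩ := exists_quadratic_factors_of_pell
    (mul_ne_zero (by norm_num : (4 : ℂ) ≠ 0) hm) hR hR4 hT hP hP6 hpell
    (by rw [hd, show (C (2 * (3 : ℕ) : ℂ)) = (6 : ℂ[X]) by norm_num; rfl]) (hnot hP.ne_zero hP₁)
    (hnot (m := -m) (fun h => by
      have := natDegree_sub_C (p := P) (a := 4 * m)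
      rw [h, hP6] at this
      simp at this) hP₂)
  have hRq : R = X ^ 4 + C (a₁ + a₂) * X ^ 3 + C (b₁ + b₂ + a₁ * a₂) * X ^ 2 +
      C (a₁ * b₂ + a₂ * b₁) * X ^ 1 + C (b₁ * b₂) := by
    rw [hRf]
    simp only [C_add, C_mul]
    ring
  rw [hRq] at h3 h2 h1 h0
  simp only [coeff_add, coeff_C_mul, coeff_X_pow, coeff_C] at h3 h2 h1 h0
  norm_num at h3 h2 h1 h0
  rcases mem_surface_or_mem_evenPlane e₁ e₂ h3.symm h2.symm h1.symm h0.symm with h | h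
  · exact h
  · have := hleast ⟨two_pos, hF.hasEllipticPower
      (hF.sq_periodic_of_odd (hF.odd_of_mem_evenPlane hq h))⟩
    norm_num at this

end LevelSet

/-! ### A theta function as an infinite product -/

section Theta

open Filter Set Complex

/-- The infinite product `∏ (1 - q ^ n w)` over `n ≥ 0`. -/
def qProd (q w : ℂ) : ℂ := ∏' n : ℕ, (1 - q ^ n * w)

theorem summable_norm_pow_mul {q : ℂ} (hq : ‖q‖ < 1) (w : ℂ) :
    Summable fun n : ℕ => ‖-(q ^ n * w)‖ := by
  simpa using (summable_geometric_of_lt_one (norm_nonneg _) hq).mul_right ‖w‖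

theorem differentiable_qProd {q : ℂ} (hq : ‖q‖ < 1) : Differentiable ℂ (qProd q) := by
  intro w
  have h := Summable.hasProdLocallyUniformlyOn_nat_one_add (f := fun n w => -(q ^ n * w))
    (K := Metric.ball (0 : ℂ) (‖w‖ + 1)) Metric.isOpen_ball
    ((summable_geometric_of_lt_one (norm_nonneg _) hq).mul_right (‖w‖ + 1))
    (.of_forall fun n x hx => by
      rw [norm_neg, norm_mul, norm_pow]
      gcongr
      exact (mem_ball_zero_iff.mp hx).le) (fun n => by fun_prop)
  have h2 := h.differentiableOn (.of_forall fun s => by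
    simpa [Finset.prod_fn] using DifferentiableOn.finsetProd (fun _ _ => by fun_prop))
    Metric.isOpen_ball
  have h3 := h2.differentiableAt (Metric.isOpen_ball.mem_nhds (x := w) (by simp))
  simp only [← sub_eq_add_neg] at h3
  exact h3

theorem qProd_eq_mul {q : ℂ} (hq : ‖q‖ < 1) (w : ℂ) : qProd q w = (1 - w) * qProd q (q * w) := by
  have e (n : ℕ) : 1 - q ^ (n + 1) * w = 1 + -(q ^ n * (q * w)) := by ring
  rw [qProd, tprod_eq_zero_mul', pow_zero, one_mul]
  · congr 1
    refine tprod_congr fun n => ?_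
    ring
  · simp only [e]
    exact multipliable_one_add_of_summable (summable_norm_pow_mul hq _)

theorem qProd_ne_zero {q w : ℂ} (hq : ‖q‖ < 1) (h : ∀ n : ℕ, q ^ n * w ≠ 1) : qProd q w ≠ 0 := by
  have := tprod_one_add_ne_zero_of_summable (f := fun n : ℕ => -(q ^ n * w))
    (fun n hn => h n (by linear_combination -hn)) (summable_norm_pow_mul hq w)
  simpa only [qProd, sub_eq_add_neg] using this

/-- The function `exp (2 π i z)`. -/
def expTwoPiI (z : ℂ) : ℂ := exp (2 * Real.pi * I * z)

theorem expTwoPiI_ne_zero (z : ℂ) : expTwoPiI z ≠ 0 := exp_ne_zero _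

theorem expTwoPiI_add (z w : ℂ) : expTwoPiI (z + w) = expTwoPiI z * expTwoPiI w := by
  rw [expTwoPiI, mul_add, exp_add]; rfl

theorem expTwoPiI_zero : expTwoPiI 0 = 1 := by simp [expTwoPiI]

theorem expTwoPiI_one : expTwoPiI 1 = 1 := by simp [expTwoPiI, exp_two_pi_mul_I]

theorem expTwoPiI_neg (z : ℂ) : expTwoPiI (-z) = (expTwoPiI z)⁻¹ := by
  rw [expTwoPiI, mul_neg, exp_neg]; rfl

theorem expTwoPiI_nat_mul (n : ℕ) (z : ℂ) : expTwoPiI (n * z) = expTwoPiI z ^ n := by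
  rw [expTwoPiI, expTwoPiI, ← exp_nat_mul]; ring_nf

theorem expTwoPiI_eq_one_iff {z : ℂ} : expTwoPiI z = 1 ↔ ∃ n : ℤ, z = n := by
  rw [expTwoPiI, exp_eq_one_iff]
  have h : (2 * Real.pi * I : ℂ) ≠ 0 := two_pi_I_ne_zero
  refine exists_congr fun n => ⟨fun hn => mul_left_cancel₀ h (by rw [hn]; ring), fun hn => ?_⟩
  rw [hn]
  ring

theorem differentiable_expTwoPiI : Differentiable ℂ expTwoPiI := by
  unfold expTwoPiI
  fun_prop

theorem norm_expTwoPiI_lt_one {τ : ℂ} (hτ : 0 < τ.im) : ‖expTwoPiI τ‖ < 1 :=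
  UpperHalfPlane.norm_exp_two_pi_I_lt_one ⟨τ, hτ⟩

/-- The lattice `ℤ + ℤ τ`. -/
def tauPair (τ : ℂ) (hτ : 0 < τ.im) : PeriodPair where
  ω₁ := 1
  ω₂ := τ
  indep := by
    rw [LinearIndependent.pair_iff]
    intro s t h
    have h2 := congrArg im h
    simp at h2
    have ht : t = 0 := h2.resolve_right hτ.ne'
    have h1 := congrArg re h
    simp [ht] at h1
    exact ⟨h1, ht⟩

theorem mem_lattice_tauPair {τ : ℂ} (hτ : 0 < τ.im) {z : ℂ} :
    z ∈ (tauPair τ hτ).lattice ↔ ∃ m n : ℤ, (m : ℂ) + n * τ = z := by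
  simp [PeriodPair.mem_lattice, tauPair]

/-- Up to an exponential factor, the Jacobi theta function of the lattice `ℤ + ℤ τ` that vanishes at
the lattice points, in its product form. -/
def thetaProd (τ z : ℂ) : ℂ :=
  qProd (expTwoPiI τ) (expTwoPiI z) * qProd (expTwoPiI τ) (expTwoPiI τ * (expTwoPiI z)⁻¹)

variable {τ : ℂ} (hτ : 0 < τ.im)
include hτ

theorem differentiable_thetaProd : Differentiable ℂ (thetaProd τ) := by
  have h1 := differentiable_qProd (norm_expTwoPiI_lt_one hτ)
  have h2 := differentiable_expTwoPiI
  have h3 : Differentiable ℂ fun z => expTwoPiI τ * (expTwoPiI z)⁻¹ :=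
    (h2.fun_inv expTwoPiI_ne_zero).const_mul _
  exact (h1.comp h2).mul (h1.comp h3)

theorem analyticAt_thetaProd (z : ℂ) : AnalyticAt ℂ (thetaProd τ) z :=
  (differentiable_thetaProd hτ).analyticAt z

omit hτ in
theorem thetaProd_add_one (z : ℂ) : thetaProd τ (z + 1) = thetaProd τ z := by
  simp only [thetaProd, expTwoPiI_add, expTwoPiI_one, mul_one]

theorem thetaProd_add_tau (z : ℂ) : thetaProd τ (z + τ) = -(expTwoPiI z)⁻¹ * thetaProd τ z := by
  have hq := norm_expTwoPiI_lt_one hτ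
  have h1 := expTwoPiI_ne_zero z
  have h2 := expTwoPiI_ne_zero τ
  simp only [thetaProd, expTwoPiI_add]
  rw [qProd_eq_mul hq (expTwoPiI z), mul_inv_rev, mul_inv_cancel_left₀ h2,
    qProd_eq_mul hq (expTwoPiI z)⁻¹, mul_comm (expTwoPiI z) (expTwoPiI τ)]
  field_simp
  ring

theorem hasDerivAt_thetaProd_zero :
    HasDerivAt (thetaProd τ) (-(2 * Real.pi * I) * qProd (expTwoPiI τ) (expTwoPiI τ) ^ 2) 0 := by
  have hq := norm_expTwoPiI_lt_one hτ
  have h1 := differentiable_qProd hq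
  have h2 := differentiable_expTwoPiI
  set g : ℂ → ℂ := fun z => qProd (expTwoPiI τ) (expTwoPiI τ * expTwoPiI z) *
    qProd (expTwoPiI τ) (expTwoPiI τ * (expTwoPiI z)⁻¹) with hg
  have hgd : Differentiable ℂ g :=
    (h1.comp (h2.const_mul _)).mul (h1.comp ((h2.fun_inv expTwoPiI_ne_zero).const_mul _))
  have he : HasDerivAt expTwoPiI (2 * Real.pi * I) 0 := by
    have := ((hasDerivAt_id (0 : ℂ)).const_mul (2 * Real.pi * I)).cexp
    simp only [id, mul_zero, exp_zero, mul_one, one_mul] at this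
    exact this
  have hθ : thetaProd τ = fun z => (1 - expTwoPiI z) * g z := by
    funext z
    rw [thetaProd, qProd_eq_mul hq (expTwoPiI z), hg, mul_assoc]
  rw [hθ]
  convert! (he.const_sub 1).mul (hgd 0).hasDerivAt using 1
  simp [hg, expTwoPiI_zero]
  ring

theorem deriv_thetaProd_zero_ne : deriv (thetaProd τ) 0 ≠ 0 := by
  rw [(hasDerivAt_thetaProd_zero hτ).deriv]
  refine mul_ne_zero (neg_ne_zero.mpr two_pi_I_ne_zero) (pow_ne_zero 2 ?_)
  refine qProd_ne_zero (norm_expTwoPiI_lt_one hτ) fun n hn => ?_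
  have h1 := congrArg norm hn
  rw [← pow_succ, norm_pow, norm_one] at h1
  exact (pow_lt_one₀ (norm_nonneg _) (norm_expTwoPiI_lt_one hτ) n.succ_ne_zero).ne h1

theorem mem_lattice_of_thetaProd_eq_zero {z : ℂ} (h : thetaProd τ z = 0) :
    z ∈ (tauPair τ hτ).lattice := by
  have hq := norm_expTwoPiI_lt_one hτ
  rw [mem_lattice_tauPair]
  rcases mul_eq_zero.mp h with h | h
  · by_contra hcon
    refine qProd_ne_zero hq (fun n hn => hcon ?_) h
    rw [← expTwoPiI_nat_mul, ← expTwoPiI_add, expTwoPiI_eq_one_iff] at hn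
    obtain ⟨m, hm⟩ := hn
    exact ⟨m, -n, by push_cast; linear_combination -hm⟩
  · by_contra hcon
    refine qProd_ne_zero hq (fun n hn => hcon ?_) h
    rw [← expTwoPiI_nat_mul, ← expTwoPiI_neg, ← expTwoPiI_add, ← expTwoPiI_add,
      expTwoPiI_eq_one_iff] at hn
    obtain ⟨m, hm⟩ := hn
    exact ⟨-m, n + 1, by push_cast; linear_combination hm⟩

open Classical in
/-- The theta function has simple zeros at the lattice points, and no other zeros. -/
theorem meromorphicOrderAt_thetaProd (z : ℂ) : meromorphicOrderAt (thetaProd τ) z =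
    ((if z ∈ (tauPair τ hτ).lattice then 1 else 0 : ℤ) : WithTop ℤ) := by
  have han := analyticAt_thetaProd hτ
  split_ifs with hz
  · have p1 : Function.Periodic (meromorphicOrderAt (thetaProd τ)) 1 := fun z => by
      rw [← meromorphicOrderAt_fun_comp_add_const_eq_meromorphicOrderAt]
      simp only [thetaProd_add_one]
    have p2 : Function.Periodic (meromorphicOrderAt (thetaProd τ)) τ := fun z => by
      rw [← meromorphicOrderAt_fun_comp_add_const_eq_meromorphicOrderAt]
      simp only [thetaProd_add_tau hτ]
      refine meromorphicOrderAt_mul_of_ne_zero (g := fun z => -(expTwoPiI z)⁻¹) ?_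
        (neg_ne_zero.mpr (inv_ne_zero (expTwoPiI_ne_zero z)))
      exact ((differentiable_expTwoPiI.analyticAt z).fun_inv (expTwoPiI_ne_zero z)).neg
    obtain ⟨m, n, rfl⟩ := (mem_lattice_tauPair hτ).mp hz
    have e1 := p1.int_mul m 0
    have e2 := p2.int_mul n m
    rw [mul_one, zero_add] at e1
    rw [e2, e1, (han 0).meromorphicOrderAt_eq,
      (han 0).analyticOrderAt_eq_one_of_zero_deriv_ne_zero ?_ (deriv_thetaProd_zero_ne hτ)]
    · rfl
    · rw [thetaProd, qProd_eq_mul (norm_expTwoPiI_lt_one hτ), expTwoPiI_zero]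
      ring
  · rw [(han z).meromorphicOrderAt_eq, (han z).analyticOrderAt_eq_zero.mpr fun h =>
      hz (mem_lattice_of_thetaProd_eq_zero hτ h)]
    rfl

theorem thetaProd_eq_zero_iff {z : ℂ} : thetaProd τ z = 0 ↔ z ∈ (tauPair τ hτ).lattice := by
  refine ⟨mem_lattice_of_thetaProd_eq_zero hτ, fun h => ?_⟩
  by_contra hne
  have h1 := (analyticAt_thetaProd hτ z).meromorphicOrderAt_eq
  rw [(analyticAt_thetaProd hτ z).analyticOrderAt_eq_zero.mpr hne,
    meromorphicOrderAt_thetaProd hτ, if_pos h] at h1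
  exact absurd h1 (by simp)

end Theta

/-! ### Elliptic functions of level `N` as quotients of theta functions -/

section ThetaQuotient

open Filter Set Complex

/-- The quotient `θ (z) / θ (z - 1 / N)`, normalized to have derivative `1` at the origin. -/
def thetaQuotient (τ : ℂ) (N : ℕ) (z : ℂ) : ℂ :=
  thetaProd τ (-(1 / N)) / deriv (thetaProd τ) 0 * thetaProd τ z / thetaProd τ (z - 1 / N)

variable {τ : ℂ} (hτ : 0 < τ.im) {N : ℕ} (hN : 2 ≤ N)

include hτ in
theorem thetaProd_zero : thetaProd τ 0 = 0 :=
  (thetaProd_eq_zero_iff hτ).mpr (Submodule.zero_mem _)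

include hN in
theorem one_div_notMem_lattice : (1 / N : ℂ) ∉ (tauPair τ hτ).lattice := by
  rw [mem_lattice_tauPair]
  rintro ⟨m, n, h⟩
  have hN0 : (N : ℂ) ≠ 0 := by exact_mod_cast (by omega : N ≠ 0)
  have him := congrArg im h
  have hi : (1 / N : ℂ).im = 0 := by
    rw [one_div, ← ofReal_natCast, ← ofReal_inv, ofReal_im]
  rw [hi] at him
  simp at him
  have hn : n = 0 := him.resolve_right hτ.ne'
  rw [hn, Int.cast_zero, zero_mul, add_zero, eq_div_iff hN0] at h
  have h' : m * (N : ℤ) = 1 := by exact_mod_cast h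
  have := Int.eq_one_or_neg_one_of_mul_eq_one' h'
  omega

include hN in
theorem thetaProd_sub_ne_zero {z : ℂ} (hz : z ∈ (tauPair τ hτ).lattice) :
    thetaProd τ (z - 1 / N) ≠ 0 := by
  rw [Ne, thetaProd_eq_zero_iff hτ]
  intro h
  exact one_div_notMem_lattice hτ hN (by simpa using Submodule.sub_mem _ hz h)

include hτ hN in
theorem thetaQuotient_const_ne_zero :
    thetaProd τ (-(1 / N)) / deriv (thetaProd τ) 0 ≠ 0 :=
  div_ne_zero (by simpa using thetaProd_sub_ne_zero hτ hN (Submodule.zero_mem _))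
    (deriv_thetaProd_zero_ne hτ)

theorem thetaQuotient_add_one (z : ℂ) : thetaQuotient τ N (z + 1) = thetaQuotient τ N z := by
  rw [thetaQuotient, thetaProd_add_one, show z + 1 - 1 / (N : ℂ) = z - 1 / N + 1 by ring,
    thetaProd_add_one, thetaQuotient]

include hτ in
theorem thetaQuotient_add_tau (z : ℂ) :
    thetaQuotient τ N (z + τ) = expTwoPiI (-(1 / N)) * thetaQuotient τ N z := by
  rw [thetaQuotient, thetaProd_add_tau hτ, show z + τ - 1 / (N : ℂ) = z - 1 / N + τ by ring,
    thetaProd_add_tau hτ, thetaQuotient, sub_eq_add_neg, expTwoPiI_add]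
  have h1 := expTwoPiI_ne_zero z
  have h2 := expTwoPiI_ne_zero (-(1 / N))
  by_cases h : thetaProd τ (z + -(1 / N)) = 0
  · rw [h, mul_zero, div_zero, div_zero, mul_zero]
  · field_simp

include hτ in
theorem analyticAt_thetaProd_sub (c z : ℂ) : AnalyticAt ℂ (fun z => thetaProd τ (z - c)) z :=
  AnalyticAt.comp (g := thetaProd τ) (f := fun z => z - c) (analyticAt_thetaProd hτ _)
    (by fun_prop)

include hτ hN in
theorem meromorphicNFAt_thetaQuotient (z : ℂ) : MeromorphicNFAt (thetaQuotient τ N) z := by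
  refine MeromorphicNFOn.div
    (f := fun z => thetaProd τ (-(1 / N)) / deriv (thetaProd τ) 0 * thetaProd τ z)
    (g := fun z => thetaProd τ (z - 1 / N))
    (analyticAt_const.mul (analyticAt_thetaProd hτ z))
    (analyticAt_thetaProd_sub hτ _ z).meromorphicNFAt ?_
  by_cases h : z ∈ (tauPair τ hτ).lattice
  · exact Or.inl (thetaProd_sub_ne_zero hτ hN h)
  · exact Or.inr (mul_ne_zero (thetaQuotient_const_ne_zero hτ hN)
      (mt (thetaProd_eq_zero_iff hτ).mp h))

include hN in
open Classical in
theorem meromorphicOrderAt_thetaQuotient (z : ℂ) : meromorphicOrderAt (thetaQuotient τ N) z =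
    (((if z ∈ (tauPair τ hτ).lattice then 1 else 0) -
      (if z - 1 / N ∈ (tauPair τ hτ).lattice then 1 else 0) : ℤ) : WithTop ℤ) := by
  have h1 := meromorphicOrderAt_div
    (f := fun z => thetaProd τ (-(1 / N)) / deriv (thetaProd τ) 0 * thetaProd τ z)
    (g := fun z => thetaProd τ (z - 1 / N))
    (analyticAt_const.mul (analyticAt_thetaProd hτ z)).meromorphicAt
    (analyticAt_thetaProd_sub hτ _ z).meromorphicAt
  have h2 := meromorphicOrderAt_mul_of_ne_zero (x := z) (f := thetaProd τ)
    (g := fun _ => thetaProd τ (-(1 / N)) / deriv (thetaProd τ) 0) analyticAt_const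
    (thetaQuotient_const_ne_zero hτ hN)
  have h3 := h2.trans (meromorphicOrderAt_thetaProd hτ z)
  refine h1.trans ?_
  rw [meromorphicOrderAt_fun_comp_sub_const_eq_meromorphicOrderAt,
    meromorphicOrderAt_thetaProd hτ, WithTop.LinearOrderedAddCommGroup.coe_sub]
  congr 1

include hτ hN in
theorem hasDerivAt_thetaQuotient_zero : HasDerivAt (thetaQuotient τ N) 1 0 := by
  have h0 : thetaProd τ (0 - 1 / N) ≠ 0 := thetaProd_sub_ne_zero hτ hN (Submodule.zero_mem _)
  have h1 := (differentiable_thetaProd hτ 0).hasDerivAt.const_mul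
    (thetaProd τ (-(1 / N)) / deriv (thetaProd τ) 0)
  have h2 := (analyticAt_thetaProd_sub hτ (1 / N) 0).differentiableAt.hasDerivAt
  convert! h1.div h2 h0 using 1
  rw [thetaProd_zero hτ, div_mul_cancel₀ _ (deriv_thetaProd_zero_ne hτ)]
  rw [zero_sub] at h0 ⊢
  field_simp
  ring

theorem notMem_lattice_of_im_eq {z : ℂ} (hz : z.im = τ.im / 2) : z ∉ (tauPair τ hτ).lattice := by
  rw [mem_lattice_tauPair]
  rintro ⟨m, n, rfl⟩
  simp at hz
  have h1 : (2 * n : ℝ) = 1 := mul_right_cancel₀ hτ.ne' (by linear_combination 2 * hz)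
  have h2 : 2 * n = 1 := by exact_mod_cast h1
  omega

include hN in
theorem hasEllipticPower_thetaQuotient_iff (k : ℕ) :
    HasEllipticPower (tauPair τ hτ) k (thetaQuotient τ N) ↔ N ∣ k := by
  classical
  have hN0 : (N : ℂ) ≠ 0 := by exact_mod_cast (by omega : N ≠ 0)
  have hζ : expTwoPiI (-(1 / N)) ^ k = 1 ↔ N ∣ k := by
    rw [← expTwoPiI_nat_mul, expTwoPiI_eq_one_iff]
    constructor
    · rintro ⟨n, hn⟩
      have h1 : (k : ℂ) = N * (-n : ℤ) := by
        push_cast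
        rw [← hn]
        field_simp
      have h2 : (k : ℤ) = N * (-n) := by exact_mod_cast h1
      exact Int.natCast_dvd_natCast.mp ⟨_, h2⟩
    · rintro ⟨n, rfl⟩
      refine ⟨-n, ?_⟩
      push_cast
      field_simp
  rw [← hζ]
  constructor
  · rintro ⟨hper, -⟩
    have h1 := hper τ (tauPair τ hτ).ω₂_mem_lattice (τ / 2)
    simp only [thetaQuotient_add_tau hτ, mul_pow] at h1
    refine mul_right_cancel₀ (pow_ne_zero k ?_) (h1.trans (one_mul _).symm)
    have h2 : thetaProd τ (τ / 2) ≠ 0 := mt (thetaProd_eq_zero_iff hτ).mp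
      (notMem_lattice_of_im_eq hτ (by simp))
    have h3 : thetaProd τ (τ / 2 - 1 / N) ≠ 0 := mt (thetaProd_eq_zero_iff hτ).mp
      (notMem_lattice_of_im_eq hτ (by
        rw [one_div, ← ofReal_natCast, ← ofReal_inv, sub_im, ofReal_im]
        simp))
    exact div_ne_zero (mul_ne_zero (thetaQuotient_const_ne_zero hτ hN) h2) h3
  · intro h
    have p1 : Function.Periodic (fun z => thetaQuotient τ N z ^ k) 1 := fun z => by
      simp only [thetaQuotient_add_one]
    have p2 : Function.Periodic (fun z => thetaQuotient τ N z ^ k) τ := fun z => by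
      simp only [thetaQuotient_add_tau hτ, mul_pow, h, one_mul]
    refine ⟨fun ω hω => ?_, 1 / N, fun z => ?_⟩
    · obtain ⟨m, n, rfl⟩ := (mem_lattice_tauPair hτ).mp hω
      simpa using (p1.int_mul m).add_period (p2.int_mul n)
    · rw [fun_meromorphicOrderAt_pow (meromorphicNFAt_thetaQuotient hτ hN z).meromorphicAt,
        meromorphicOrderAt_thetaQuotient hτ hN,
        show (k : WithTop ℤ) = ((k : ℤ) : WithTop ℤ) from rfl, ← WithTop.coe_mul]
      congr 1
      split_ifs <;> simp

include hN in
theorem isEllipticOfLevel_thetaQuotient :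
    IsEllipticOfLevel N (tauPair τ hτ) (thetaQuotient τ N) := by
  refine ⟨fun z _ => meromorphicNFAt_thetaQuotient hτ hN z, ?_,
    (hasDerivAt_thetaQuotient_zero hτ hN).deriv, ⟨by omega, ?_⟩, fun k hk => ?_⟩
  · simp [thetaQuotient, thetaProd_zero hτ]
  · exact (hasEllipticPower_thetaQuotient_iff hτ hN N).mpr dvd_rfl
  · exact Nat.le_of_dvd hk.1 ((hasEllipticPower_thetaQuotient_iff hτ hN k).mp hk.2)

/-- The pair of periods `μ⁻¹ ω₁`, `μ⁻¹ ω₂`. -/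
def PeriodPair.scale (L : PeriodPair) {μ : ℂ} (hμ : μ ≠ 0) : PeriodPair where
  ω₁ := μ⁻¹ * L.ω₁
  ω₂ := μ⁻¹ * L.ω₂
  indep := by
    have h := L.indep
    rw [LinearIndependent.pair_iff] at h ⊢
    intro s t hst
    refine h s t (mul_left_cancel₀ (inv_ne_zero hμ) ?_)
    rw [mul_zero, ← hst]
    simp only [real_smul]
    ring

theorem PeriodPair.mem_lattice_scale {L : PeriodPair} {μ : ℂ} (hμ : μ ≠ 0) {z : ℂ} :
    z ∈ (L.scale hμ).lattice ↔ μ * z ∈ L.lattice := by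
  simp only [PeriodPair.mem_lattice, PeriodPair.scale]
  refine exists_congr fun m => exists_congr fun n => ⟨fun h => ?_, fun h => ?_⟩
  · rw [← h]
    field_simp
  · apply mul_left_cancel₀ hμ
    rw [← h]
    field_simp

theorem HasEllipticPower.scale {L : PeriodPair} {k : ℕ} {F : ℂ → ℂ} {μ : ℂ} (hμ : μ ≠ 0)
    (h : HasEllipticPower L k F) :
    HasEllipticPower (L.scale hμ) k (fun z => μ⁻¹ * F (μ * z)) := by
  classical
  obtain ⟨hper, ρ, hord⟩ := h
  refine ⟨fun ω hω z => ?_, μ⁻¹ * ρ, fun z => ?_⟩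
  · have := hper _ ((PeriodPair.mem_lattice_scale hμ).mp hω) (μ * z)
    simp only [mul_pow, mul_add] at this ⊢
    rw [this]
  · have h1 := meromorphicOrderAt_comp_of_deriv_ne_zero (x := z) (f := fun w => F w ^ k)
      (g := fun z => μ * z) (by fun_prop)
      (by simpa using hμ)
    have h2 := meromorphicOrderAt_mul_of_ne_zero (x := z) (f := (fun w => F w ^ k) ∘ fun z => μ * z)
      (g := fun _ => μ⁻¹ ^ k) analyticAt_const (pow_ne_zero _ (inv_ne_zero hμ))
    simp only [mul_pow, PeriodPair.mem_lattice_scale]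
    refine h2.trans (h1.trans ?_)
    rw [hord]
    simp only [mul_sub, mul_inv_cancel_left₀ hμ]

theorem IsEllipticOfLevel.scale {L : PeriodPair} {F : ℂ → ℂ} {μ : ℂ} (hμ : μ ≠ 0)
    (h : IsEllipticOfLevel N L F) :
    IsEllipticOfLevel N (L.scale hμ) (fun z => μ⁻¹ * F (μ * z)) := by
  obtain ⟨hNF, h0, h1, ⟨hpos, hp⟩, hleast⟩ := h
  refine ⟨fun z _ => ?_, by simp [h0], ?_, ⟨hpos, hp.scale hμ⟩, fun k hk => hleast ⟨hk.1, ?_⟩⟩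
  · have h2 : MeromorphicNFAt (F ∘ fun z => μ * z) z :=
      (hNF (mem_univ _)).comp_analyticAt (g := fun z => μ * z) (by fun_prop)
    exact (meromorphicNFAt_mul_iff_right (g := fun _ => μ⁻¹) analyticAt_const
      (inv_ne_zero hμ)).mpr h2
  · have hd : DifferentiableAt ℂ F 0 := differentiableAt_of_deriv_ne_zero (by simp [h1])
    have h2 : HasDerivAt (fun z => F (μ * z)) (1 * (μ * 1)) 0 :=
      HasDerivAt.comp (h₂ := F) (h := fun z => μ * z) 0 (by simpa [h1] using hd.hasDerivAt)
        ((hasDerivAt_id (0 : ℂ)).const_mul μ)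
    rw [(h2.const_mul μ⁻¹).deriv]
    field_simp
  · have h2 := hk.2.scale (inv_ne_zero hμ)
    have e1 : (fun z => μ⁻¹⁻¹ * (μ⁻¹ * F (μ * (μ⁻¹ * z)))) = F := by
      funext z
      rw [mul_inv_cancel_left₀ hμ, inv_mul_cancel_left₀ (inv_ne_zero hμ)]
    have e2 : (L.scale hμ).scale (inv_ne_zero hμ) = L := by
      simp only [PeriodPair.scale, inv_inv, mul_inv_cancel_left₀ hμ]
    rwa [e1, e2] at h2

end ThetaQuotient

/-! ### The Zariski closures of the parameter sets -/

section Density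

open Filter Set

variable {N : ℕ}

theorem weightedScale_mem_levelSet {L : PeriodPair} {F : ℂ → ℂ} {q : Fin 4 → ℂ} {μ : ℂ}
    (hF : IsEllipticOfLevel N L F) (hq : IsSeriesSolution q (taylorSeries F)) (hμ : μ ≠ 0) :
    weightedScale μ q ∈ levelSet N := by
  have h1 := hq.rescale hμ
  rw [← taylorSeries_scale] at h1
  obtain ⟨ρ, hG⟩ := (hF.scale hμ).exists_isLevelFunction
  exact ⟨_, h1, _, _, hF.scale hμ, isSeriesExpansion_taylorSeries hG.analyticAt_zero⟩

/-- If the parameters for `τ` and `τ'` agree up to a weighted scaling by `μ`, then the functions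
themselves agree up to scaling, and multiplication by `μ` maps one lattice into the other. -/
theorem mem_lattice_of_eq_weightedScale {τ τ' μ : ℂ} (hτ : 0 < τ.im) (hτ' : 0 < τ'.im)
    (hN : 2 ≤ N) (hμ : μ ≠ 0) {q q' : Fin 4 → ℂ}
    (hq : IsSeriesSolution q (taylorSeries (thetaQuotient τ N)))
    (hq' : IsSeriesSolution q' (taylorSeries (thetaQuotient τ' N)))
    (h : q = weightedScale μ q') {z : ℂ} (hz : z ∈ (tauPair τ hτ).lattice) :
    μ * z ∈ (tauPair τ' hτ').lattice := by
  have h1 := hq'.rescale hμ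
  rw [← h, ← taylorSeries_scale] at h1
  obtain ⟨_, hF⟩ := (isEllipticOfLevel_thetaQuotient hτ hN).exists_isLevelFunction
  obtain ⟨_, hG⟩ :=
    ((isEllipticOfLevel_thetaQuotient hτ' hN).scale hμ).exists_isLevelFunction
  have heq := eventuallyEq_of_taylorSeries_eq hF.analyticAt_zero hG.analyticAt_zero (hq.unique h1)
  set c := thetaProd τ (-(1 / N)) / deriv (thetaProd τ) 0 with hc
  set c' := thetaProd τ' (-(1 / N)) / deriv (thetaProd τ') 0 with hc'
  have hcz' : c' ≠ 0 := thetaQuotient_const_ne_zero hτ' hN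
  -- cross-multiplied, the identity between the two quotients holds between entire functions
  have hd := differentiable_thetaProd hτ
  have hd' := differentiable_thetaProd hτ'
  have e1 : Differentiable ℂ fun z => c * thetaProd τ z * (μ * thetaProd τ' (μ * z - 1 / N)) :=
    (hd.const_mul c).mul ((hd'.comp (by fun_prop : Differentiable ℂ fun z : ℂ =>
      μ * z - 1 / N)).const_mul μ)
  have e2 : Differentiable ℂ fun z => c' * thetaProd τ' (μ * z) * thetaProd τ (z - 1 / N) :=
    ((hd'.comp (by fun_prop : Differentiable ℂ fun z : ℂ => μ * z)).const_mul c').mul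
      (hd.comp (by fun_prop : Differentiable ℂ fun z : ℂ => z - 1 / N))
  have hloc : (fun z => c * thetaProd τ z * (μ * thetaProd τ' (μ * z - 1 / N))) =ᶠ[𝓝 0]
      fun z => c' * thetaProd τ' (μ * z) * thetaProd τ (z - 1 / N) := by
    have n1 : ∀ᶠ z in 𝓝 (0 : ℂ), thetaProd τ (z - 1 / N) ≠ 0 :=
      (analyticAt_thetaProd_sub hτ (1 / N) 0).continuousAt.eventually_ne
        (thetaProd_sub_ne_zero hτ hN (Submodule.zero_mem _))
    have n2 : ∀ᶠ z in 𝓝 (0 : ℂ), thetaProd τ' (μ * z - 1 / N) ≠ 0 := by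
      have hcont : Continuous fun z => thetaProd τ' (μ * z - 1 / N) :=
        hd'.continuous.comp (by fun_prop)
      refine hcont.continuousAt.eventually_ne ?_
      rw [mul_zero]
      exact thetaProd_sub_ne_zero hτ' hN (Submodule.zero_mem _)
    filter_upwards [heq, n1, n2] with z hz h1 h2
    simp only [thetaQuotient] at hz
    rw [← hc, ← hc', div_eq_iff h1] at hz
    rw [hz]
    field_simp
  have hglob := AnalyticOnNhd.eq_of_eventuallyEq (fun z _ => e1.analyticAt z)
    (fun z _ => e2.analyticAt z) hloc
  have h2 := congrFun hglob z
  simp only [(thetaProd_eq_zero_iff hτ).mpr hz, mul_zero, zero_mul] at h2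
  rw [← thetaProd_eq_zero_iff hτ']
  have h3 := (mul_eq_zero.mp h2.symm).resolve_right (thetaProd_sub_ne_zero hτ hN hz)
  exact (mul_eq_zero.mp h3).resolve_left hcz'

/-- There are uncountably many orbits of parameters of level `N` under weighted scaling: `τ` ranges
over the upper half plane, and at most countably many `τ` yield the same orbit. -/
theorem exists_parameter_family (hN : 2 ≤ N) : ∃ q : ℂ → Fin 4 → ℂ,
    (∀ τ : ℂ, 0 < τ.im → ∀ μ ≠ 0, weightedScale μ (q τ) ∈ levelSet N) ∧
    ∀ B : Set ℂ, (∀ τ ∈ B, 0 < τ.im) →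
      (∀ τ ∈ B, ∀ τ' ∈ B, ∃ μ ≠ 0, q τ = weightedScale μ (q τ')) → B.Countable := by
  have hex (τ : ℂ) (hτ : 0 < τ.im) :
      ∃ q, IsSeriesSolution q (taylorSeries (thetaQuotient τ N)) := by
    obtain ⟨q, -, hq⟩ := (isEllipticOfLevel_thetaQuotient hτ hN).exists_isSeriesSolution
    exact ⟨q, hq⟩
  choose! q hq using hex
  refine ⟨q, fun τ hτ μ hμ => weightedScale_mem_levelSet (isEllipticOfLevel_thetaQuotient hτ hN)
    (hq τ hτ) hμ, fun B hB h => ?_⟩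
  rcases B.eq_empty_or_nonempty with rfl | ⟨τ', hτ'B⟩
  · exact countable_empty
  have hτ' := hB τ' hτ'B
  refine (countable_range fun m : (ℤ × ℤ) × (ℤ × ℤ) =>
    ((m.1.1 : ℂ) + m.1.2 * τ') / (m.2.1 + m.2.2 * τ')).mono fun τ hτB => ?_
  have hτ := hB τ hτB
  obtain ⟨μ, hμ, hμq⟩ := h τ hτB τ' hτ'B
  have h1 := mem_lattice_of_eq_weightedScale hτ hτ' hN hμ (hq τ hτ) (hq τ' hτ') hμq
    (tauPair τ hτ).ω₁_mem_lattice
  have h2 := mem_lattice_of_eq_weightedScale hτ hτ' hN hμ (hq τ hτ) (hq τ' hτ') hμq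
    (tauPair τ hτ).ω₂_mem_lattice
  obtain ⟨a, b, hab⟩ := (mem_lattice_tauPair hτ').mp h2
  obtain ⟨c, d, hcd⟩ := (mem_lattice_tauPair hτ').mp h1
  refine ⟨((a, b), (c, d)), ?_⟩
  simp only [hab, hcd, tauPair]
  field_simp

theorem not_countable_upperHalfPlane : ¬ {τ : ℂ | 0 < τ.im}.Countable := by
  intro h
  have hopen : IsOpen {τ : ℂ | 0 < τ.im} := isOpen_lt continuous_const Complex.continuous_im
  obtain ⟨z, hz, hz'⟩ := (h.dense_compl ℂ).inter_open_nonempty _ hopen ⟨Complex.I, by simp⟩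
  exact hz' hz

/-- A map on an uncountable set with countable fibres takes infinitely many values. -/
theorem infinite_image_of_countable_fibers {α β : Type*} {s : Set α} {r : α → β}
    (hs : ¬ s.Countable) (h : ∀ b, {a ∈ s | r a = b}.Countable) : (r '' s).Infinite := by
  intro hfin
  refine hs ((hfin.countable.biUnion fun b _ => h b).mono fun a ha => ?_)
  exact mem_biUnion (mem_image_of_mem r ha) ⟨ha, rfl⟩

/-- A polynomial vanishing at infinitely many points of a polynomial curve vanishes on it. -/
theorem eval_eq_zero_of_infinite {n : ℕ} (p : MvPolynomial (Fin n) ℂ) {f : ℂ → Fin n → ℂ}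
    (P : Fin n → Polynomial ℂ) (hP : ∀ s i, (P i).eval s = f s i) {S : Set ℂ} (hS : S.Infinite)
    (h : ∀ s ∈ S, MvPolynomial.eval (f s) p = 0) (s : ℂ) : MvPolynomial.eval (f s) p = 0 := by
  have key (s : ℂ) : (MvPolynomial.aeval P p).eval s = MvPolynomial.eval (f s) p := by
    clear h
    induction p using MvPolynomial.induction_on with
    | C a => simp
    | add p q hp hq => simp [hp, hq]
    | mul_X p i hp => simp [hp, hP]
  have h0 : MvPolynomial.aeval P p = 0 :=
    Polynomial.eq_zero_of_infinite_isRoot _ (hS.mono fun s hs => (key s).trans (h s hs))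
  rw [← key, h0, Polynomial.eval_zero]

theorem infinite_ne_zero : {x : ℂ | x ≠ 0}.Infinite := (finite_singleton (0 : ℂ)).infinite_compl

theorem weightedScale_one (q : Fin 4 → ℂ) : weightedScale 1 q = q := by
  funext i
  simp [weightedScale]

theorem weightedScale_surfaceMap (μ x t : ℂ) :
    weightedScale μ (surfaceMap x t) = surfaceMap (μ * x) (μ * t) := by
  funext i
  fin_cases i <;> simp [weightedScale, surfaceMap] <;> ring

theorem levelVariety_six : levelVariety 6 = surface := by
  refine zariski_closure_eq isClosed_surface (fun q hq => (levelSet_six_subset hq).2) fun p hp => ?_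
  obtain ⟨q, hq, hcount⟩ := exists_parameter_family (N := 6) (by norm_num)
  have hex (τ : ℂ) (hτ : 0 < τ.im) : ∃ x t : ℂ, x ≠ 0 ∧ q τ = surfaceMap x t := by
    have h1 := hq τ hτ 1 one_ne_zero
    rw [weightedScale_one] at h1
    obtain ⟨h0, x, t, hxt⟩ := levelSet_six_subset h1
    refine ⟨x, t, ?_, hxt⟩
    rw [hxt] at h0
    exact h0
  choose! x t hx hxt using hex
  have hinf : ((fun τ => t τ / x τ) '' {τ : ℂ | 0 < τ.im}).Infinite := by
    refine infinite_image_of_countable_fibers not_countable_upperHalfPlane fun b =>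
      hcount _ (fun τ hτ => hτ.1) ?_
    rintro τ ⟨hτ, hb⟩ τ' ⟨hτ', hb'⟩
    have n1 := hx τ hτ
    have n2 := hx τ' hτ'
    refine ⟨x τ / x τ', div_ne_zero n1 n2, ?_⟩
    rw [hxt τ hτ, hxt τ' hτ', weightedScale_surfaceMap, div_mul_cancel₀ _ n2]
    congr 1
    rw [← hb', div_eq_div_iff n1 n2] at hb
    field_simp
    linear_combination hb
  have h1 (a : ℂ) (ha : a ≠ 0) (s : ℂ) : MvPolynomial.eval (surfaceMap a (a * s)) p = 0 := by
    refine eval_eq_zero_of_infinite p (f := fun s => surfaceMap a (a * s)) (![.C a,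
      .C (a ^ 2) * (2 * .X ^ 2 - 1), .C (a ^ 3) * (6 * .X - .C (4 / 3) - 6 * .X ^ 2),
      .C (a ^ 4) * (.C (13 / 15) + .C (52 / 5) * .X ^ 2 + .C (14 / 5) * .X ^ 4 -
        .C (24 / 5) * .X - .C (48 / 5) * .X ^ 3)] : Fin 4 → Polynomial ℂ)
      (fun s i => by fin_cases i <;> simp [surfaceMap] <;> ring) hinf ?_ s
    rintro _ ⟨τ, hτ, rfl⟩
    have h2 := hp _ (hq τ hτ (a / x τ) (div_ne_zero ha (hx τ hτ)))
    rw [hxt τ hτ, weightedScale_surfaceMap, div_mul_cancel₀ _ (hx τ hτ)] at h2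
    rw [← h2, div_mul_eq_mul_div, mul_div_assoc]
  rintro _ ⟨a, s, rfl⟩
  refine eval_eq_zero_of_infinite p (f := fun a => surfaceMap a s) (![.X,
    .C (2 * s ^ 2) - .X ^ 2,
    .C (6 * s) * .X ^ 2 - .C (4 / 3) * .X ^ 3 - .C (6 * s ^ 2) * .X,
    .C (13 / 15) * .X ^ 4 + .C (52 / 5 * s ^ 2) * .X ^ 2 + .C (14 / 5 * s ^ 4) -
      .C (24 / 5 * s) * .X ^ 3 - .C (48 / 5 * s ^ 3) * .X] : Fin 4 → Polynomial ℂ)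
    (fun a i => by fin_cases i <;> simp [surfaceMap]) infinite_ne_zero (fun a ha => ?_) a
  have := h1 a ha (s / a)
  rwa [mul_div_cancel₀ _ ha] at this

theorem levelVariety_two : levelVariety 2 = evenPlane := by
  refine zariski_closure_eq isClosed_evenPlane levelSet_two_subset fun p hp => ?_
  obtain ⟨q, hq, hcount⟩ := exists_parameter_family (N := 2) le_rfl
  have heven (τ : ℂ) (hτ : 0 < τ.im) : q τ ∈ evenPlane := by
    have h1 := hq τ hτ 1 one_ne_zero
    rw [weightedScale_one] at h1
    exact levelSet_two_subset h1
  have hscale {τ τ' μ : ℂ} (hτ : 0 < τ.im) (hτ' : 0 < τ'.im) (h1 : q τ 1 = μ ^ 2 * q τ' 1)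
      (h3 : q τ 3 = μ ^ 4 * q τ' 3) : q τ = weightedScale μ (q τ') := by
    obtain ⟨a0, a2⟩ := heven τ hτ
    obtain ⟨b0, b2⟩ := heven τ' hτ'
    funext i
    fin_cases i <;> simp [weightedScale, a0, a2, b0, b2, h1, h3]
  have hroot (n : ℕ) (hn : n ≠ 0) {a b : ℂ} (ha : a ≠ 0) (hb : b ≠ 0) :
      ∃ μ ≠ 0, a = μ ^ n * b := by
    obtain ⟨μ, hμ⟩ := IsAlgClosed.exists_pow_nat_eq (a / b) (Nat.pos_of_ne_zero hn)
    refine ⟨μ, fun h0 => div_ne_zero ha hb ?_, by rw [hμ, div_mul_cancel₀ _ hb]⟩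
    rw [← hμ, h0, zero_pow hn]
  set H : Set ℂ := {τ | 0 < τ.im ∧ q τ 1 ≠ 0} with hH
  have hHc : ¬ H.Countable := by
    intro hc
    have c1 : {τ : ℂ | 0 < τ.im ∧ q τ 1 = 0 ∧ q τ 3 ≠ 0}.Countable := by
      refine hcount _ (fun τ hτ => hτ.1) ?_
      rintro τ ⟨hτ, h1, h3⟩ τ' ⟨hτ', h1', h3'⟩
      obtain ⟨μ, hμ, h⟩ := hroot 4 (by norm_num) h3 h3'
      exact ⟨μ, hμ, hscale hτ hτ' (by rw [h1, h1', mul_zero]) h⟩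
    have c2 : {τ : ℂ | 0 < τ.im ∧ q τ 1 = 0 ∧ q τ 3 = 0}.Countable := by
      refine hcount _ (fun τ hτ => hτ.1) ?_
      rintro τ ⟨hτ, h1, h3⟩ τ' ⟨hτ', h1', h3'⟩
      exact ⟨1, one_ne_zero, hscale hτ hτ' (by rw [h1, h1', mul_zero]) (by rw [h3, h3', mul_zero])⟩
    refine not_countable_upperHalfPlane (((hc.union c1).union c2).mono fun τ hτ => ?_)
    by_cases h1 : q τ 1 = 0
    · by_cases h3 : q τ 3 = 0
      · exact Or.inr ⟨hτ, h1, h3⟩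
      · exact Or.inl (Or.inr ⟨hτ, h1, h3⟩)
    · exact Or.inl (Or.inl ⟨hτ, h1⟩)
  have hinf : ((fun τ => q τ 3 / q τ 1 ^ 2) '' H).Infinite := by
    refine infinite_image_of_countable_fibers hHc fun b => hcount _ (fun τ hτ => hτ.1.1) ?_
    rintro τ ⟨⟨hτ, h1⟩, hb⟩ τ' ⟨⟨hτ', h1'⟩, hb'⟩
    obtain ⟨μ, hμ, h⟩ := hroot 2 two_ne_zero h1 h1'
    refine ⟨μ, hμ, hscale hτ hτ' h ?_⟩
    rw [div_eq_iff (pow_ne_zero 2 h1)] at hb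
    rw [div_eq_iff (pow_ne_zero 2 h1')] at hb'
    rw [hb, hb', h]
    ring
  have h1 (a : ℂ) (ha : a ≠ 0) (s : ℂ) : MvPolynomial.eval ![0, a, 0, a ^ 2 * s] p = 0 := by
    refine eval_eq_zero_of_infinite p (f := fun s => ![0, a, 0, a ^ 2 * s])
      (![0, .C a, 0, .C (a ^ 2) * .X] : Fin 4 → Polynomial ℂ)
      (fun s i => by fin_cases i <;> simp) hinf ?_ s
    rintro _ ⟨τ, ⟨hτ, hτ1⟩, rfl⟩
    obtain ⟨μ, hμ, h⟩ := hroot 2 two_ne_zero ha hτ1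
    refine (congrArg (fun v => MvPolynomial.eval v p) ?_).trans (hp _ (hq τ hτ μ hμ))
    obtain ⟨a0, a2⟩ := heven τ hτ
    funext i
    fin_cases i
    · simp [weightedScale, a0]
    · simp [weightedScale, h]
    · simp [weightedScale, a2]
    · simp [weightedScale, h]
      field_simp
  rintro y ⟨y0, y2⟩
  have hy : y = ![0, y 1, 0, y 3] := by
    funext i
    fin_cases i <;> simp [y0, y2]
  rw [hy]
  refine eval_eq_zero_of_infinite p (f := fun a => ![0, a, 0, y 3])
    (![0, .X, 0, .C (y 3)] : Fin 4 → Polynomial ℂ)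
    (fun a i => by fin_cases i <;> simp) infinite_ne_zero (fun a ha => ?_) (y 1)
  have := h1 a ha (y 3 / a ^ 2)
  rwa [mul_div_cancel₀ _ (pow_ne_zero 2 ha)] at this

end Density

end

theorem mainTheorem5 :
    ∃ A : Set (Fin 4 → ℂ),
      (A ≠ levelVariety 2 ∧ zariskiComponents V567 = {levelVariety 2, A}) ∧
      A = levelVariety 6 ∧
      ∀ f : PowerSeries ℂ, CorrespondsToLevel 6 f ↔ ∃ q ∈ A, IsSeriesSolution q f := by
  refine ⟨levelVariety 6, ⟨?_, ?_⟩, rfl, fun f => Iff.rfl⟩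
  · rw [levelVariety_two, levelVariety_six]
    intro h
    have h1 : surfaceMap 1 0 ∈ evenPlane := h ▸ ⟨1, 0, rfl⟩
    exact one_ne_zero h1.1
  · rw [levelVariety_two, levelVariety_six, zariskiComponents_V567]
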